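/- **Setting.** Let $n\ge 0$. An *ice quiver* $Q$ on $n$ vertices is a finite quiver without loops or directed 2-cycles, some of whose vertices are declared *frozen*; the others are *mutable*. It is encoded by the skew-symmetric integer matrix $Q_{ij}=\#(\text{arrows } i\to j)-\#(\text{arrows } j\to i)$. A *seed* $(Q,\mathbf a)$ is an ice quiver $Q$ on $n$ vertices with a family $\mathbf a=(a_1,\dots,a_n)$ of elements of $\mathbb{Q}(x_1,\dots,x_n)$. Its *mutation* at a mutable vertex $k$ is the seed $(Q',\mathbf a')$ with the same frozen vertices, with $Q'_{ij}=-Q_{ij}$ if $k\in\{i,j\}$ and $Q'_{ij}=Q_{ij}+\tfrac12\left(|Q_{ik}|Q_{kj}+Q_{ik}|Q_{kj}|\right)$ otherwise, and with $a_i'=a_i$ for $i\ne k$ and $$a_k'=\Big(\prod_{Q_{kj}>0}a_j^{Q_{kj}}+\prod_{Q_{kj}<0}a_j^{-Q_{kj}}\Big)a_k^{-1}.$$ Two seeds are *mutation-equivalent* if one is obtained from the other by a finite sequence of mutations. Let $(Q,\mathbf a)$ be a seed with $a_1,\dots,a_n$ algebraically independent over $\mathbb{Q}$ (for example $a_i=x_i$).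 Its *cluster algebra* $\mathcal A=\mathcal A(Q,\mathbf a)$ is the subring of $\mathbb{Q}(x_1,\dots,x_n)$ generated by all elements of all clusters of seeds mutation-equivalent to $(Q,\mathbf a)$ (the *cluster variables*) and by the inverses of the frozen variables; these mutation-equivalent seeds are the seeds of $\mathcal A$. It is *acyclic* if it has a seed in whose quiver there is no directed cycle of mutable vertices. For a seed $(P,\mathbf b)$ of $\mathcal A$ and a set $S$ of mutable vertices, let $\mathcal A'$ be the cluster algebra of the seed obtained from $(P,\mathbf b)$ by also declaring the vertices in $S$ frozen. If $\mathcal A'=\mathcal A[b_j^{-1}: j\in S]$, then $\mathcal A'$ is called a *cluster localization* of $\mathcal A$, and the open set of points of $\operatorname{Spec}\mathcal A$ at which no $b_j$, $j\in S$, vanishes is the corresponding *cluster chart*; the chart is *acyclic* if $\mathcal A'$ is. The cluster algebra $\mathcal A$ is *locally acyclic* if $\operatorname{Spec}\mathcal A$ is the union of finitely many acyclic cluster charts. A commutative ring is a *complete intersection* if it is isomorphic to the quotient of a regular (Noetherian) ring by a regular sequence, and *locally a complete intersection* if every point of its spectrum has a basic open neighbourhood $D(f)$ such that the localization at $f$ is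 a complete intersection. **Theorem 4.2.** If $\mathcal A$ is locally acyclic, then $\mathcal A$ is finitely generated as a ring (that is, as a $\mathbb{Z}$-algebra), integrally closed in its fraction field, and locally a complete intersection. -/

import Mathlib

universe u

/-- An ice quiver with vertex set `ι`: a finite quiver without loops or directed 2-cycles, given by
its skew-symmetric matrix `arrows i j = #(arrows from i to j) - #(arrows from j to i)`, which
determines it, together with a set of frozen vertices. The other vertices are mutable. -/
structure IceQuiver (ι : Type u) where
  arrows : ι → ι → ℤ
  skew : ∀ i j, arrows i j = -arrows j i
  frozen : Set ι

namespace IceQuiver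

variable {ι : Type u}

/-- Mutation of an ice quiver at a vertex `k`. (The division by 2 is always exact.) -/
def mutate [DecidableEq ι] (Q : IceQuiver ι) (k : ι) : IceQuiver ι where
  arrows i j :=
    if i = k ∨ j = k then -Q.arrows i j
    else Q.arrows i j +
      (|Q.arrows i k| * Q.arrows k j + Q.arrows i k * |Q.arrows k j|) / 2
  skew i j := by
    by_cases h : i = k ∨ j = k
    · rw [if_pos h, if_pos h.symm, Q.skew i j]
    · rw [if_neg h, if_neg (fun h' => h h'.symm), Q.skew i j, Q.skew i k, Q.skew k j, abs_neg,
        abs_neg]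
      have e : |Q.arrows k i| * -Q.arrows j k + -Q.arrows k i * |Q.arrows j k|
          = -(|Q.arrows j k| * Q.arrows k i + Q.arrows j k * |Q.arrows k i|) := by ring
      have hd : (2 : ℤ) ∣ |Q.arrows j k| * Q.arrows k i + Q.arrows j k * |Q.arrows k i| := by
        rcases abs_choice (Q.arrows j k) with h1 | h1 <;>
          rcases abs_choice (Q.arrows k i) with h2 | h2 <;> rw [h1, h2]
        · exact ⟨Q.arrows j k * Q.arrows k i, by ring⟩
        · exact ⟨0, by ring⟩
        · exact ⟨0, by ring⟩
        · exact ⟨-(Q.arrows j k * Q.arrows k i), by ring⟩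
      rw [e, Int.neg_ediv_of_dvd hd]
      ring
  frozen := Q.frozen

/-- Freezing the vertices in `S`. -/
def freeze (Q : IceQuiver ι) (S : Set ι) : IceQuiver ι where
  arrows := Q.arrows
  skew := Q.skew
  frozen := Q.frozen ∪ S

/-- There is an arrow from the mutable vertex `i` to the mutable vertex `j`. -/
def MutableArrow (Q : IceQuiver ι) (i j : ι) : Prop :=
  i ∉ Q.frozen ∧ j ∉ Q.frozen ∧ 0 < Q.arrows i j

/-- The induced subquiver on the mutable vertices has no directed cycle. -/
def IsAcyclic (Q : IceQuiver ι) : Prop :=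
  ∀ i, ¬ Relation.TransGen Q.MutableArrow i i

end IceQuiver

/-- The field `ℚ(x_i : i ∈ ι)` of rational functions. -/
abbrev RationalFunctions (ι : Type u) : Type u := FractionRing (MvPolynomial ι ℚ)

/-- A seed: an ice quiver together with a rational function attached to each vertex. -/
structure ClusterSeed (ι : Type u) where
  quiver : IceQuiver ι
  cluster : ι → RationalFunctions ι

namespace ClusterSeed

variable {ι : Type u}

/-- The initial seed of an ice quiver: the cluster is `(x_i)`. -/
noncomputable def initial (Q : IceQuiver ι) : ClusterSeed ι where
  quiver := Q
  cluster i := algebraMap (MvPolynomial ι ℚ) (RationalFunctions ι) (MvPolynomial.X i)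

/-- Mutation of a seed at the vertex `k`: the variable `a_k` is replaced by
`(∏_{Q_kj > 0} a_j ^ Q_kj + ∏_{Q_kj < 0} a_j ^ (-Q_kj)) / a_k`.
(`Int.toNat` is the positive part, so the other factors are equal to `1`.) -/
noncomputable def mutate [Fintype ι] [DecidableEq ι] (s : ClusterSeed ι) (k : ι) :
    ClusterSeed ι where
  quiver := s.quiver.mutate k
  cluster := Function.update s.cluster k
    ((∏ j, s.cluster j ^ (s.quiver.arrows k j).toNat +
      ∏ j, s.cluster j ^ (-s.quiver.arrows k j).toNat) * (s.cluster k)⁻¹)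

/-- Freezing the variables of a seed at the vertices in `S`. -/
def freeze (s : ClusterSeed ι) (S : Set ι) : ClusterSeed ι where
  quiver := s.quiver.freeze S
  cluster := s.cluster

section

variable [Fintype ι] [DecidableEq ι]

/-- `t` is obtained from `s` by a sequence of mutations at mutable vertices. -/
def MutationEquiv : ClusterSeed ι → ClusterSeed ι → Prop :=
  Relation.ReflTransGen fun s t => ∃ k, k ∉ s.quiver.frozen ∧ t = s.mutate k

/-- The cluster variables (frozen ones included): the rational functions occurring in some seed
that is mutation-equivalent to `s`. -/
def clusterVariables (s : ClusterSeed ι) : Set (RationalFunctions ι) :=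
  {f | ∃ t, MutationEquiv s t ∧ ∃ i, f = t.cluster i}

/-- The inverses of the frozen variables (these are the same in all mutation-equivalent seeds). -/
def frozenInverses (s : ClusterSeed ι) : Set (RationalFunctions ι) :=
  {f | ∃ i ∈ s.quiver.frozen, f = (s.cluster i)⁻¹}

/-- The cluster algebra `𝒜(Q, a)`: the subring of `ℚ(x_i : i ∈ ι)` generated by the cluster variables
and the inverses of the frozen variables. -/
noncomputable def clusterAlgebra (s : ClusterSeed ι) : Subring (RationalFunctions ι) :=
  Subring.closure (s.clusterVariables ∪ s.frozenInverses)

/-- The cluster algebra of `s` is acyclic: it has an acyclic seed. -/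
def IsAcyclicClusterAlgebra (s : ClusterSeed ι) : Prop :=
  ∃ t, MutationEquiv s t ∧ t.quiver.IsAcyclic

/-- The pair `(t, S)` determines an acyclic cluster localization of the cluster algebra `𝒜` of `s`:
`t` is a seed of `𝒜`, `S` is a set of mutable vertices of `t`, the cluster algebra `𝒜'` of the
freezing of `t` at `S` equals the localization `𝒜[a_j⁻¹ : j ∈ S]`, and `𝒜'` is acyclic. -/
structure IsAcyclicLocalization (s t : ClusterSeed ι) (S : Set ι) : Prop where
  mutationEquiv : MutationEquiv s t
  isMutable : ∀ j ∈ S, j ∉ t.quiver.frozen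
  eq_localization : (t.freeze S).clusterAlgebra =
    Subring.closure ((s.clusterAlgebra : Set (RationalFunctions ι)) ∪
      {f | ∃ j ∈ S, f = (t.cluster j)⁻¹})
  isAcyclic : (t.freeze S).IsAcyclicClusterAlgebra

/-- The cluster chart of the pair `(t, S)`, an open subset of the spectrum of the cluster algebra
of `s`: the points at which none of the variables `a_j`, `j ∈ S`, of `t` vanishes. -/
def clusterChart (s t : ClusterSeed ι) (S : Set ι) : Set (PrimeSpectrum s.clusterAlgebra) :=
  {p | ∀ j ∈ S, t.cluster j ∉ (fun y : s.clusterAlgebra => (y : RationalFunctions ι)) ''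
    (p.asIdeal : Set s.clusterAlgebra)}

/-- The cluster algebra of `s` is locally acyclic: its spectrum has a finite cover by acyclic
cluster charts. -/
def IsLocallyAcyclic (s : ClusterSeed ι) : Prop :=
  ∃ (r : ℕ) (t : Fin r → ClusterSeed ι) (S : Fin r → Set ι),
    (∀ i, IsAcyclicLocalization s (t i) (S i)) ∧ ⋃ i, clusterChart s (t i) (S i) = Set.univ

end

end ClusterSeed

/-- A commutative ring is a complete intersection if it is the quotient of a regular ring by a
regular sequence. -/
def IsCompleteIntersectionRing (A : Type u) [CommRing A] : Prop :=
  ∃ (R : Type u) (_ : CommRing R) (_ : IsRegularRing R) (rs : List R),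
    RingTheory.Sequence.IsRegular R rs ∧ Nonempty (A ≃+* R ⧸ Ideal.ofList rs)

/-- A commutative ring is locally a complete intersection if every point of its spectrum has a
basic open neighbourhood `D(f)` whose ring of functions `A[1/f]` is a complete intersection. -/
def IsLocallyCompleteIntersectionRing (A : Type u) [CommRing A] : Prop :=
  ∀ p : PrimeSpectrum A, ∃ f : A, f ∉ p.asIdeal ∧
    IsCompleteIntersectionRing (Localization.Away f)

/-!
The three properties are local on the spectrum, so it suffices to find, around every point, a basic
open set whose ring of functions has them. These rings are the lower bounds of *isolated* seeds,
that is, of seeds without arrows between mutable vertices.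

*The cover.* Let `t` be an acyclic seed and let a point of the spectrum be given. The mutable
variables vanishing at the point span an acyclic quiver. If this quiver had an arrow, then some
vertex `k` of it would receive an arrow from, but not emit an arrow to, the vanishing variables, and
exactly one of the two monomials in the exchange relation `a_k a_k' = M + M'` would vanish. So
freezing the variables that do not vanish at the point leaves an isolated seed
(`ClusterSeed.isIsolated_freeze_of_isAcyclic`). Together with the charts of the definition of local
acyclicity this gives `ClusterSeed.IsLocallyAcyclic.exists_isLocalizationAt`.

*Isolated seeds.* For an isolated seed, the exchange binomials `P_i = a_i a_i'` involve frozen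
variables only, so the lower bound `ℤ[a_i, a_i']` is obtained by adjoining pairs `a`, `P / a` one
after the other; a frozen variable is a pair with `P = 1`. Each step is a quotient `B[X, Y] / (XY - P)`
(`dvd_of_pairEval_eq_zero`), which makes the lower bound a complete intersection
(`IsCompleteIntersectionRing.closure_pair`). Moreover `B[a, a⁻¹] ∩ B[a', a'⁻¹] = B[a, a']`
(`mem_closure_pair_of_mem_of_mem`), so the lower bound is the intersection of the rings of Laurent
polynomials in the clusters of the seed (`ClusterSeed.mem_lowerBound_of_forall`). Hence it is
integrally closed, and it contains every element that is a Laurent polynomial in each of these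
clusters. By the Laurent phenomenon this applies to all cluster variables, also to those created by
mutations at the newly frozen vertices; therefore inverting the newly frozen variables turns the
cluster algebra into the lower bound (`ClusterSeed.isLocalizationAt_lowerBound_freeze`).

*The Laurent phenomenon* (`ClusterSeed.MutationEquiv.cluster_mem_laurentRing`) is proved by
induction on the length of a word `i, j, …` of mutations. By induction a variable `f` at the end of
the word is a Laurent polynomial in the clusters of `μ_i s` and of `μ_i μ_j μ_i s`. If some vertex
is joined to `i` by a single arrow and not joined to `j`, then the exchange binomial at `i` is a
prime element of the ring of Laurent polynomials in the cluster of `s`, and it divides no variable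
of `μ_i μ_j μ_i s`, so `f` is in this ring, too (`ClusterSeed.mem_laurentRing_of_three_mutations`). The general case follows by
attaching a new vertex to `i` and setting its variable to `1`.
-/

/-! ### Regular sequences and the rings `B[a, P / a]` -/

open Polynomial in
/-- The evaluation `R[X][Y] → K` extending `g : R → K` with `X ↦ a` and `Y ↦ b`. -/
noncomputable def pairEval {R K : Type*} [CommRing R] [CommRing K] (g : R →+* K) (a b : K) :
    R[X][X] →+* K :=
  eval₂RingHom (eval₂RingHom g a) b

section PairEval

open Polynomial

variable {R K : Type*} [CommRing R] [Field K] (g : R →+* K) (a b : K)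

@[simp]
theorem pairEval_C_C (r : R) : pairEval g a b (C (C r)) = g r := by simp [pairEval]

@[simp]
theorem pairEval_C_X : pairEval g a b (C X) = a := by simp [pairEval]

@[simp]
theorem pairEval_X : pairEval g a b X = b := by simp [pairEval]

theorem pairEval_C (p : R[X]) : pairEval g a b (C p) = eval₂ g a p := by simp [pairEval]

theorem range_pairEval :
    (pairEval g a b).range = Subring.closure ((g.range : Set K) ∪ {a, b}) := by
  apply le_antisymm
  · rintro _ ⟨f, rfl⟩
    set B := Subring.closure ((g.range : Set K) ∪ {a, b})
    have hg : ∀ r, g r ∈ B := fun r => Subring.subset_closure (Or.inl ⟨r, rfl⟩)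
    have ha : a ∈ B := Subring.subset_closure (by simp)
    have hb : b ∈ B := Subring.subset_closure (by simp)
    have hC : ∀ p : R[X], pairEval g a b (C p) ∈ B := by
      intro p
      induction p using Polynomial.induction_on' with
      | add p q hp hq => rw [C_add, map_add]; exact B.add_mem hp hq
      | monomial n r =>
        rw [← C_mul_X_pow_eq_monomial, C_mul, C_pow, map_mul, map_pow, pairEval_C_C, pairEval_C_X]
        exact B.mul_mem (hg r) (B.pow_mem ha n)
    induction f using Polynomial.induction_on' with
    | add p q hp hq => rw [map_add]; exact B.add_mem hp hq
    | monomial n p =>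
      rw [← C_mul_X_pow_eq_monomial, map_mul, map_pow, pairEval_X]
      exact B.mul_mem (hC p) (B.pow_mem hb n)
  · rw [Subring.closure_le]
    rintro _ (⟨r, rfl⟩ | rfl | rfl)
    · exact ⟨C (C r), by simp⟩
    · exact ⟨C X, by simp⟩
    · exact ⟨X, by simp⟩

/-- If `a` is transcendental over the domain `R`, the only relation over `R` between `a` and `P / a`
is `a * (P / a) = P`. Modulo this relation, a power of `X` times a polynomial does not involve `Y`;
and `X` is a prime not dividing `X * Y - P`. -/
theorem dvd_of_pairEval_eq_zero [IsDomain R] (ha : ∀ p : R[X], eval₂ g a p = 0 → p = 0) {P : R}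
    (hP : P ≠ 0) (hab : g P = a * b) {f : R[X][X]} (hf : pairEval g a b f = 0) :
    (C X * X - C (C P) : R[X][X]) ∣ f := by
  set r : R[X][X] := C X * X - C (C P) with hr
  have hr0 : pairEval g a b r = 0 := by simp [hr, hab]
  have key : ∀ f : R[X][X], ∃ (n : ℕ) (F : R[X]), r ∣ (C X) ^ n * f - C F := by
    intro f
    induction f using Polynomial.induction_on' with
    | add p q hp hq =>
      obtain ⟨n, F, u, hu⟩ := hp
      obtain ⟨m, G, v, hv⟩ := hq
      refine ⟨n + m, X ^ m * F + X ^ n * G, (C X) ^ m * u + (C X) ^ n * v, ?_⟩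
      simp only [C_add, C_mul, C_pow]
      linear_combination (C X) ^ m * hu + (C X) ^ n * hv
    | monomial n p =>
      refine ⟨n, p * C P ^ n, ?_⟩
      have : (C X * X - C (C P) : R[X][X]) ∣ (C X * X) ^ n - (C (C P)) ^ n :=
        sub_dvd_pow_sub_pow _ _ _
      obtain ⟨u, hu⟩ := this
      refine ⟨C p * u, ?_⟩
      rw [← C_mul_X_pow_eq_monomial, C_mul, C_pow]
      linear_combination C p * hu
  obtain ⟨n, F, u, hu⟩ := key f
  have hF : F = 0 := by
    apply ha
    have := congrArg (pairEval g a b) hu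
    rw [map_sub, map_mul, map_mul, hf, hr0, pairEval_C] at this
    simpa using this
  rw [hF, C_0, sub_zero] at hu
  have hXp : Prime (C X : R[X][X]) := prime_C_iff.2 prime_X
  have hXr : ¬ (C X : R[X][X]) ∣ r := by
    intro h
    have h2 : (C X : R[X][X]) ∣ C (C P) := by
      have := (dvd_mul_right (C X : R[X][X]) X).sub h
      simpa [hr] using this
    obtain ⟨q, hq⟩ := h2
    have h3 := congrArg (fun p : R[X][X] => (p.coeff 0).coeff 0) hq
    simp at h3
    exact hP h3
  obtain ⟨v, hv⟩ := hXp.pow_dvd_of_dvd_mul_left n hXr (Dvd.intro _ hu)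
  refine ⟨v, mul_left_cancel₀ (pow_ne_zero n hXp.ne_zero) ?_⟩
  rw [hu, hv]
  ring

end PairEval

/-- Adjoining to a complete intersection domain `C` a transcendental element `a` together with
`b = P / a`, where `0 ≠ P ∈ C`, gives a complete intersection. If `C = R / (rs)`, the new ring is
`R[X, Y] / (rs, X * Y - P)`. -/
theorem IsCompleteIntersectionRing.closure_pair {K : Type u} [Field K] {B : Subring K}
    (hB : IsCompleteIntersectionRing B) {a b P : K} (ha : Transcendental B a) (hPB : P ∈ B)
    (hP : P ≠ 0) (hab : P = a * b) :
    IsCompleteIntersectionRing (Subring.closure ((B : Set K) ∪ {a, b})) := by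
  obtain ⟨R, _, _, rs, hrs, ⟨e⟩⟩ := hB
  let q : R →+* B := (e.symm : R ⧸ Ideal.ofList rs →+* B).comp (Ideal.Quotient.mk _)
  have hq : Function.Surjective q := e.symm.surjective.comp Ideal.Quotient.mk_surjective
  have hqk : RingHom.ker q = Ideal.ofList rs := by
    ext x
    simp [q, RingHom.mem_ker, Ideal.Quotient.eq_zero_iff_mem]
  obtain ⟨P', hP'⟩ := hq ⟨P, hPB⟩
  let Φ : Polynomial (Polynomial R) →+* Polynomial (Polynomial B) := Polynomial.mapRingHom (Polynomial.mapRingHom q)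
  let ι₂ : R →+* Polynomial (Polynomial R) := Polynomial.C.comp Polynomial.C
  have hΦs : Function.Surjective Φ :=
    Polynomial.map_surjective _ (Polynomial.map_surjective _ hq)
  have hΦk : RingHom.ker Φ = Ideal.ofList (rs.map ι₂) := by
    rw [← Ideal.map_ofList, ← hqk]
    simp only [Φ, ι₂, Polynomial.ker_mapRingHom, Ideal.map_map]
  let r : Polynomial (Polynomial R) := Polynomial.C Polynomial.X * Polynomial.X - Polynomial.C (Polynomial.C P')
  have hΦr : Φ r = Polynomial.C Polynomial.X * Polynomial.X
      - Polynomial.C (Polynomial.C ⟨P, hPB⟩) := by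
    simp [Φ, r, hP']
  have hPB0 : (⟨P, hPB⟩ : B) ≠ 0 := fun h => hP (congrArg Subtype.val h)
  have hr0 : Φ r ≠ 0 := by
    rw [hΦr]
    intro h
    have := congrArg (fun p : Polynomial (Polynomial B) => (p.coeff 0).coeff 0) h
    simp at this
    exact hP this
  let Ψ : Polynomial (Polynomial R) →+* K := (pairEval B.subtype a b).comp Φ
  have hkill : pairEval B.subtype a b (Φ r) = 0 := by
    rw [hΦr]; simp [← hab]
  have hΨrange : Ψ.range = Subring.closure ((B : Set K) ∪ {a, b}) := by
    have h1 := range_pairEval B.subtype a b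
    rw [B.range_subtype] at h1
    rw [← h1]
    ext y
    constructor
    · rintro ⟨x, rfl⟩; exact ⟨Φ x, rfl⟩
    · rintro ⟨x, rfl⟩
      obtain ⟨z, rfl⟩ := hΦs x
      exact ⟨z, rfl⟩
  have hlist : Ideal.ofList (rs.map ι₂ ++ [r]) = RingHom.ker Φ ⊔ Ideal.span {r} := by
    rw [Ideal.ofList_append, Ideal.ofList_singleton, hΦk]
  have hΨk : RingHom.ker Ψ = Ideal.ofList (rs.map ι₂ ++ [r]) := by
    rw [hlist]
    apply le_antisymm
    · intro f hf
      have hf' : pairEval B.subtype a b (Φ f) = 0 := hf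
      obtain ⟨v, hv⟩ := dvd_of_pairEval_eq_zero B.subtype a b
        (fun p hp => by
          by_contra hne
          exact ha ⟨p, hne, hp⟩) hPB0 hab hf'
      rw [← hΦr] at hv
      obtain ⟨w, rfl⟩ := hΦs v
      have h1 : f - r * w ∈ RingHom.ker Φ := by
        rw [RingHom.mem_ker, map_sub, map_mul, hv, sub_self]
      have h2 : f = (f - r * w) + r * w := by ring
      rw [h2]
      exact Ideal.add_mem _ (Ideal.mem_sup_left h1)
        (Ideal.mem_sup_right (Ideal.mem_span_singleton'.2 ⟨w, mul_comm _ _⟩))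
    · refine sup_le ?_ ?_
      · intro f hf
        have hf' : Φ f = 0 := hf
        simp [Ψ, RingHom.mem_ker, hf']
      · rw [Ideal.span_singleton_le_iff_mem]
        exact hkill
  refine ⟨Polynomial (Polynomial R), inferInstance, inferInstance,
    rs.map ι₂ ++ [r], ⟨?_, ?_⟩, ⟨?_⟩⟩
  · rw [RingTheory.Sequence.isWeaklyRegular_append_iff]
    constructor
    · have h1 : RingTheory.Sequence.IsWeaklyRegular (Polynomial R)
          (rs.map (algebraMap R (Polynomial R))) := hrs.toIsWeaklyRegular.of_flat
      have h2 : RingTheory.Sequence.IsWeaklyRegular (Polynomial (Polynomial R))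
        ((rs.map (algebraMap R (Polynomial R))).map
          (algebraMap (Polynomial R) (Polynomial (Polynomial R)))) := h1.of_flat
      rw [List.map_map] at h2
      exact h2
    · rw [RingTheory.Sequence.isWeaklyRegular_singleton_iff, isSMulRegular_iff_right_eq_zero_of_smul]
      intro x hx
      obtain ⟨f, rfl⟩ := Submodule.Quotient.mk_surjective _ x
      rw [← Submodule.Quotient.mk_smul, Submodule.Quotient.mk_eq_zero, smul_eq_mul,
        smul_eq_mul, Ideal.mul_top, ← hΦk, RingHom.mem_ker, map_mul] at hx
      rw [Submodule.Quotient.mk_eq_zero, smul_eq_mul, Ideal.mul_top, ← hΦk, RingHom.mem_ker]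
      exact (mul_eq_zero.1 hx).resolve_left hr0
  · rw [smul_eq_mul, Ideal.mul_top, ← hΨk]
    exact (RingHom.ker_ne_top Ψ).symm
  · exact ((Ideal.quotEquivOfEq hΨk.symm).trans
      ((RingHom.quotientKerEquivRange Ψ).trans (RingEquiv.subringCongr hΨrange))).symm

/-! ### Subrings of fields -/

section SubringsOfFields

open Polynomial

variable {K : Type*} [Field K]

theorem exists_mul_pow_eq_aeval {B : Subring K} {a y : K} (ha : a ≠ 0)
    (hy : y ∈ Subring.closure ((B : Set K) ∪ {a, a⁻¹})) :
    ∃ (n : ℕ) (p : B[X]), y * a ^ n = aeval a p := by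
  induction hy using Subring.closure_induction with
  | mem x hx =>
    rcases hx with hx | rfl | rfl
    · exact ⟨0, C ⟨x, hx⟩, by simp; rfl⟩
    · exact ⟨0, X, by simp⟩
    · exact ⟨1, 1, by simp [ha]⟩
  | zero => exact ⟨0, 0, by simp⟩
  | one => exact ⟨0, 1, by simp⟩
  | add x y _ _ hx hy =>
    obtain ⟨n, p, hp⟩ := hx
    obtain ⟨m, q, hq⟩ := hy
    refine ⟨n + m, p * X ^ m + q * X ^ n, ?_⟩
    simp only [map_add, map_mul, map_pow, aeval_X, ← hp, ← hq]
    ring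
  | neg x _ hx =>
    obtain ⟨n, p, hp⟩ := hx
    exact ⟨n, -p, by rw [map_neg, ← hp]; ring⟩
  | mul x y _ _ hx hy =>
    obtain ⟨n, p, hp⟩ := hx
    obtain ⟨m, q, hq⟩ := hy
    refine ⟨n + m, p * q, ?_⟩
    simp only [map_mul, ← hp, ← hq]
    ring

/-- If `a` is transcendental over `B` and `b = P / a` with `0 ≠ P ∈ B`, then the rings of Laurent
polynomials `B[a, a⁻¹]` and `B[b, b⁻¹]` intersect in `B[a, b]`: comparing coefficients, the
coefficient of `a⁻ᵏ` in an element of the intersection is divisible by `Pᵏ`. -/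
theorem mem_closure_pair_of_mem_of_mem {B : Subring K} {a b P y : K} (ha : Transcendental B a)
    (hPB : P ∈ B) (hP : P ≠ 0) (hab : P = a * b)
    (h₁ : y ∈ Subring.closure ((B : Set K) ∪ {a, a⁻¹}))
    (h₂ : y ∈ Subring.closure ((B : Set K) ∪ {b, b⁻¹})) :
    y ∈ Subring.closure ((B : Set K) ∪ {a, b}) := by
  have ha0 : a ≠ 0 := by rintro rfl; simp at hab; exact hP hab
  have hb0 : b ≠ 0 := by rintro rfl; simp at hab; exact hP hab
  obtain ⟨n₁, p₁, hp₁⟩ := exists_mul_pow_eq_aeval ha0 h₁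
  obtain ⟨n₂, q₁, hq₁⟩ := exists_mul_pow_eq_aeval hb0 h₂
  set d := p₁.natDegree + q₁.natDegree with hd
  set n := n₁ + n₂ + d with hn
  -- After increasing the exponents, both polynomials have degree at most `2 * n`.
  set p := p₁ * X ^ (n₂ + d) with hp
  set q := q₁ * X ^ (n₁ + d) with hq
  have hpn : p.natDegree < 2 * n + 1 := by
    have := natDegree_mul_le (p := p₁) (q := X ^ (n₂ + d))
    rw [natDegree_X_pow, ← hp] at this
    omega
  have hqn : q.natDegree < 2 * n + 1 := by
    have := natDegree_mul_le (p := q₁) (q := X ^ (n₁ + d))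
    rw [natDegree_X_pow, ← hq] at this
    omega
  have hpa : y * a ^ n = aeval a p := by
    rw [hp, map_mul, ← hp₁, map_pow, aeval_X, hn]; ring
  have hqb : y * b ^ n = aeval b q := by
    rw [hq, map_mul, ← hq₁, map_pow, aeval_X, hn]; ring
  let P' : B := ⟨P, hPB⟩
  have hP' : algebraMap B K P' = P := rfl
  have hP'0 : P' ≠ 0 := fun h => hP (congrArg Subtype.val h)
  have hcoeff : ∀ k < 2 * n + 1, p.coeff k * P' ^ n = q.coeff (2 * n - k) * P' ^ (2 * n - k) := by
    set Q : B[X] := ∑ k ∈ Finset.range (2 * n + 1),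
      C (q.coeff (2 * n - k) * P' ^ (2 * n - k)) * X ^ k with hQ
    have hzero : p * C (P' ^ n) - Q = 0 := by
      by_contra hne
      refine ha ⟨_, hne, ?_⟩
      have hQa : aeval a Q = aeval b q * a ^ (2 * n) := by
        rw [aeval_eq_sum_range' hqn, hQ, map_sum, Finset.sum_mul, ← Finset.sum_range_reflect]
        refine Finset.sum_congr rfl fun k hk => ?_
        have hk' : k ≤ 2 * n := by simpa [Nat.lt_succ_iff] using hk
        have e1 : 2 * n + 1 - 1 - k = 2 * n - k := by omega
        have e2 : 2 * n - (2 * n - k) = k := by omega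
        rw [e1, e2]
        simp only [map_mul, aeval_C, map_pow, aeval_X, hP', Algebra.smul_def]
        have e3 : a ^ (2 * n) = a ^ k * a ^ (2 * n - k) := by rw [← pow_add]; congr 1; omega
        rw [e3, hab, mul_pow]
        ring
      rw [map_sub, hQa, map_mul, ← hpa, ← hqb, aeval_C, map_pow, hP', hab, mul_pow]
      ring
    intro k hk
    have h3 := congrArg (fun f : B[X] => f.coeff k) hzero
    simp only [coeff_sub, coeff_mul_C, coeff_zero, hQ, finsetSum_coeff, coeff_C_mul_X_pow] at h3
    rw [Finset.sum_ite_eq, if_pos (Finset.mem_range.2 hk)] at h3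
    exact sub_eq_zero.1 h3
  set L := Subring.closure ((B : Set K) ∪ {a, b}) with hL
  have hBL : ∀ c : B, (c : K) ∈ L := fun c => Subring.subset_closure (Or.inl c.2)
  have haL : a ∈ L := Subring.subset_closure (by simp)
  have hbL : b ∈ L := Subring.subset_closure (by simp)
  have hy : y = ∑ k ∈ Finset.range (2 * n + 1), (p.coeff k : K) * a ^ k / a ^ n := by
    rw [← Finset.sum_div, eq_div_iff (pow_ne_zero n ha0), hpa, aeval_eq_sum_range' hpn]
    rfl
  rw [hy]
  refine L.sum_mem fun k hk => ?_
  have hk' := Finset.mem_range.1 hk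
  rcases le_or_gt n k with h | h
  · have : (p.coeff k : K) * a ^ k / a ^ n = p.coeff k * a ^ (k - n) := by
      rw [div_eq_iff (pow_ne_zero n ha0), mul_assoc, ← pow_add]
      congr 2; omega
    rw [this]
    exact L.mul_mem (hBL _) (L.pow_mem haL _)
  · have h4 : p.coeff k = q.coeff (2 * n - k) * P' ^ (n - k) := by
      apply mul_right_cancel₀ (pow_ne_zero n hP'0)
      rw [hcoeff k hk', mul_assoc, ← pow_add]
      congr 2; omega
    have : (p.coeff k : K) * a ^ k / a ^ n = q.coeff (2 * n - k) * b ^ (n - k) := by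
      rw [div_eq_iff (pow_ne_zero n ha0), h4]
      have e4 : a ^ n = a ^ (n - k) * a ^ k := by rw [← pow_add]; congr 1; omega
      have e5 : ((P' : B) : K) = P := rfl
      rw [Subring.coe_mul, Subring.coe_pow, e5, hab, e4, mul_pow]
      ring
    rw [this]
    exact L.mul_mem (hBL _) (L.pow_mem hbL _)

/-- A subring `B` of a field is integrally closed if and only if it contains every fraction of
elements of `B` that is integral over `B`. -/
theorem isIntegrallyClosed_subring_iff (B : Subring K) :
    IsIntegrallyClosed B ↔
      ∀ y : K, (∃ b ∈ B, b ≠ 0 ∧ y * b ∈ B) → IsIntegral B y → y ∈ B := by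
  have hinj : Function.Injective (Algebra.ofId B K) := Subtype.val_injective
  let φ : FractionRing B →ₐ[B] K := IsFractionRing.liftAlgHom hinj
  have hφ : Function.Injective φ := φ.toRingHom.injective
  rw [isIntegrallyClosed_iff (FractionRing B)]
  constructor
  · rintro h y ⟨b, hb, hb0, hyb⟩ hy
    have hb0' : (algebraMap B (FractionRing B) ⟨b, hb⟩) ≠ 0 := by
      rw [Ne, FaithfulSMul.algebraMap_eq_zero_iff]
      exact fun h => hb0 (congrArg Subtype.val h)
    set x : FractionRing B := algebraMap B _ ⟨y * b, hyb⟩ / algebraMap B _ ⟨b, hb⟩ with hx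
    have hxy : φ x = y := by
      rw [hx, map_div₀, φ.commutes, φ.commutes]
      exact mul_div_cancel_right₀ y hb0
    obtain ⟨z, hz⟩ := h ((isIntegral_algHom_iff φ hφ).1 (hxy.symm ▸ hy))
    rw [← hxy, ← hz, φ.commutes]
    exact z.2
  · intro h x hx
    obtain ⟨c, b, hb, rfl⟩ := IsFractionRing.div_surjective (A := B) x
    have hb0 : b ≠ 0 := nonZeroDivisors.ne_zero hb
    have hb0' : (b : K) ≠ 0 := fun h => hb0 (Subtype.ext h)
    have hφx : φ (algebraMap B _ c / algebraMap B _ b) = (c : K) / b := by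
      rw [map_div₀, φ.commutes, φ.commutes]; rfl
    have := h _ ⟨b, b.2, hb0', by rw [hφx, div_mul_cancel₀ _ hb0']; exact c.2⟩
      ((isIntegral_algHom_iff φ hφ).2 hx)
    refine ⟨⟨_, this⟩, hφ ?_⟩
    rw [φ.commutes]
    rfl

/-- The intersection `B` of a family of integrally closed subrings of a field is integrally closed. -/
theorem isIntegrallyClosed_of_forall {σ : Sort*} {B : Subring K} (T : σ → Subring K)
    (hT : ∀ i, IsIntegrallyClosed (T i)) (hBT : ∀ i, B ≤ T i)
    (hB : ∀ y, (∀ i, y ∈ T i) → y ∈ B) : IsIntegrallyClosed B := by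
  rw [isIntegrallyClosed_subring_iff]
  rintro y ⟨b, hb, hb0, hyb⟩ hy
  refine hB y fun i => (isIntegrallyClosed_subring_iff (T i)).1 (hT i) y
    ⟨b, hBT i hb, hb0, hBT i hyb⟩ ?_
  let := (Subring.inclusion (hBT i)).toAlgebra
  have : IsScalarTower B (T i) K := IsScalarTower.of_algebraMap_eq fun _ => rfl
  exact hy.tower_top

/-- If powers of `f ∈ A` are common denominators in `A` of the elements of `X`, then also of the
elements of the ring generated by `X`. -/
theorem Subring.exists_mul_pow_mem_of_mem_closure {A : Subring K} {f y : K} {X : Set K}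
    (hf : f ∈ A) (hX : ∀ x ∈ X, ∃ n : ℕ, x * f ^ n ∈ A) (hy : y ∈ closure X) :
    ∃ n : ℕ, y * f ^ n ∈ A := by
  induction hy using Subring.closure_induction with
  | mem x hx => exact hX x hx
  | zero => exact ⟨0, by simp⟩
  | one => exact ⟨0, by simp⟩
  | add x y _ _ hx hy =>
    obtain ⟨n, hn⟩ := hx
    obtain ⟨m, hm⟩ := hy
    refine ⟨n + m, ?_⟩
    have : (x + y) * f ^ (n + m) = x * f ^ n * f ^ m + y * f ^ m * f ^ n := by ring
    rw [this]
    exact A.add_mem (A.mul_mem hn (A.pow_mem hf _)) (A.mul_mem hm (A.pow_mem hf _))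
  | neg x _ hx =>
    obtain ⟨n, hn⟩ := hx
    exact ⟨n, by rw [neg_mul]; exact A.neg_mem hn⟩
  | mul x y _ _ hx hy =>
    obtain ⟨n, hn⟩ := hx
    obtain ⟨m, hm⟩ := hy
    refine ⟨n + m, ?_⟩
    have : x * y * f ^ (n + m) = x * f ^ n * (y * f ^ m) := by ring
    rw [this]
    exact A.mul_mem hn hm

/-- `L` is the localization `A[f⁻¹]` of `A`, as subrings of a field. -/
structure Subring.IsLocalizationAt (A L : Subring K) (f : K) : Prop where
  mem : f ∈ A
  ne_zero : f ≠ 0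
  le : A ≤ L
  inv_mem : f⁻¹ ∈ L
  exists_mul_pow_mem : ∀ y ∈ L, ∃ n : ℕ, y * f ^ n ∈ A

namespace Subring.IsLocalizationAt

theorem isLocalization {A L : Subring K} {f : K} (h : A.IsLocalizationAt L f) :
    letI := (Subring.inclusion h.le).toAlgebra
    IsLocalization.Away (⟨f, h.mem⟩ : A) L := by
  let := (Subring.inclusion h.le).toAlgebra
  refine IsLocalization.Away.mk _ ?_ ?_ ?_
  · refine IsUnit.of_mul_eq_one ⟨f⁻¹, h.inv_mem⟩ (Subtype.ext ?_)
    exact mul_inv_cancel₀ h.ne_zero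
  · intro y
    obtain ⟨n, hn⟩ := h.exists_mul_pow_mem y y.2
    exact ⟨n, ⟨_, hn⟩, Subtype.ext rfl⟩
  · intro a b hab
    exact ⟨0, by rw [Subring.inclusion_injective h.le hab]⟩

theorem trans {A B C : Subring K} {f g : K} (hf : A.IsLocalizationAt B f)
    (hg : B.IsLocalizationAt C g) (hgA : g ∈ A) : A.IsLocalizationAt C (f * g) where
  mem := A.mul_mem hf.mem hgA
  ne_zero := mul_ne_zero hf.ne_zero hg.ne_zero
  le := hf.le.trans hg.le
  inv_mem := by
    rw [mul_inv]
    exact C.mul_mem (hg.le hf.inv_mem) hg.inv_mem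
  exists_mul_pow_mem y hy := by
    obtain ⟨n, hn⟩ := hg.exists_mul_pow_mem y hy
    obtain ⟨m, hm⟩ := hf.exists_mul_pow_mem _ hn
    refine ⟨m + n, ?_⟩
    have : y * (f * g) ^ (m + n) = (y * g ^ n * f ^ m) * (f ^ n * g ^ m) := by ring
    rw [this]
    exact A.mul_mem hm (A.mul_mem (A.pow_mem hf.mem _) (A.pow_mem hgA _))

theorem of_closure {A : Subring K} {f : K} {X : Set K} (hf : f ∈ A) (hf0 : f ≠ 0)
    (hA : A ≤ closure X) (hinv : f⁻¹ ∈ closure X) (hX : ∀ x ∈ X, ∃ n : ℕ, x * f ^ n ∈ A) :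
    A.IsLocalizationAt (closure X) f where
  mem := hf
  ne_zero := hf0
  le := hA
  inv_mem := hinv
  exists_mul_pow_mem _ hy := exists_mul_pow_mem_of_mem_closure hf hX hy

end Subring.IsLocalizationAt

end SubringsOfFields

/-! ### Rings of Laurent polynomials -/

/-- The ring `ℤ[xᵢ^±¹ : i ∈ ι]` of Laurent polynomials in a family of elements of a field. -/
def laurentRing {ι K : Type*} [Field K] (x : ι → K) : Subring K :=
  Subring.closure {f | ∃ i, f = x i ∨ f = (x i)⁻¹}

namespace laurentRing

variable {ι K : Type*} [Field K] {x : ι → K}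

theorem apply_mem (x : ι → K) (i : ι) : x i ∈ laurentRing x :=
  Subring.subset_closure ⟨i, Or.inl rfl⟩

theorem inv_mem (x : ι → K) (i : ι) : (x i)⁻¹ ∈ laurentRing x :=
  Subring.subset_closure ⟨i, Or.inr rfl⟩

theorem ne_zero_of_algebraicIndependent (hx : AlgebraicIndependent ℤ x) (i : ι) : x i ≠ 0 :=
  hx.ne_zero i

/-- The evaluation `Xᵢ ↦ xᵢ` from polynomials to the ring of Laurent polynomials in the `xᵢ`. -/
noncomputable def ofMvPolynomial (x : ι → K) : MvPolynomial ι ℤ →+* laurentRing x :=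
  (MvPolynomial.aeval x : MvPolynomial ι ℤ →ₐ[ℤ] K).toRingHom.codRestrict _ fun p => by
    induction p using MvPolynomial.induction_on with
    | C n => simp
    | add p q hp hq => rw [map_add]; exact add_mem hp hq
    | mul_X p i hp =>
      rw [map_mul]
      refine mul_mem hp ?_
      simpa using apply_mem x i

theorem coe_ofMvPolynomial (p : MvPolynomial ι ℤ) :
    (ofMvPolynomial x p : K) = MvPolynomial.aeval x p := rfl

variable [Fintype ι]

theorem exists_mul_prod_pow_mem {B : Subring K} (hx0 : ∀ i, x i ≠ 0) (hx : ∀ i, x i ∈ B) {y : K}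
    (hy : y ∈ laurentRing x) : ∃ n : ℕ, y * (∏ i, x i) ^ n ∈ B := by
  classical
  refine Subring.exists_mul_pow_mem_of_mem_closure (B.prod_mem fun i _ => hx i) ?_ hy
  rintro _ ⟨i, rfl | rfl⟩
  · exact ⟨0, by simpa using hx i⟩
  · refine ⟨1, ?_⟩
    rw [pow_one, ← Finset.mul_prod_erase _ _ (Finset.mem_univ i), inv_mul_cancel_left₀ (hx0 i)]
    exact B.prod_mem fun i _ => hx i

theorem isLocalization (hx : AlgebraicIndependent ℤ x) :
    let := (ofMvPolynomial x).toAlgebra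
    IsLocalization.Away (∏ i, MvPolynomial.X i : MvPolynomial ι ℤ) (laurentRing x) := by
  let := (ofMvPolynomial x).toAlgebra
  have hx0 := ne_zero_of_algebraicIndependent hx
  have hcoe : ∀ p, (algebraMap (MvPolynomial ι ℤ) (laurentRing x) p : K) =
    MvPolynomial.aeval x p := fun _ => rfl
  have hprod : (algebraMap (MvPolynomial ι ℤ) (laurentRing x) (∏ i, MvPolynomial.X i) : K) =
      ∏ i, x i := by
    rw [hcoe, map_prod]; simp
  refine IsLocalization.Away.mk _ ?_ ?_ ?_
  · refine IsUnit.of_mul_eq_one ⟨∏ i, (x i)⁻¹, Subring.prod_mem _ fun i _ => inv_mem x i⟩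
      (Subtype.ext ?_)
    rw [Subring.coe_mul, hprod, ← Finset.prod_mul_distrib]
    simp [hx0]
  · intro y
    have hX : ∀ i, x i ∈ (MvPolynomial.aeval x : MvPolynomial ι ℤ →ₐ[ℤ] K).toRingHom.range :=
      fun i => ⟨MvPolynomial.X i, by simp⟩
    obtain ⟨n, p, hp⟩ := exists_mul_prod_pow_mem hx0 hX y.2
    refine ⟨n, p, Subtype.ext ?_⟩
    rw [Subring.coe_mul, Subring.coe_pow, hprod, hcoe]
    exact hp.symm
  · intro p q hpq
    refine ⟨0, ?_⟩
    rw [hx (congrArg Subtype.val hpq : MvPolynomial.aeval x p = MvPolynomial.aeval x q)]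

theorem isIntegrallyClosed (hx : AlgebraicIndependent ℤ x) :
    IsIntegrallyClosed (laurentRing x) := by
  let := (ofMvPolynomial x).toAlgebra
  have := isLocalization hx
  refine isIntegrallyClosed_of_isLocalization (R := MvPolynomial ι ℤ) _
    (Submonoid.powers (∏ i, MvPolynomial.X i : MvPolynomial ι ℤ)) ?_
  refine powers_le_nonZeroDivisors_of_noZeroDivisors ?_
  exact Finset.prod_ne_zero_iff.2 fun i _ => MvPolynomial.X_ne_zero i

/-- Laurent polynomials in algebraically independent elements can be evaluated at any family of
nonzero elements of a field. -/
theorem exists_ringHom (hx : AlgebraicIndependent ℤ x) {F : Type*} [Field F] (v : ι → F)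
    (hv : ∀ i, v i ≠ 0) :
    ∃ φ : laurentRing x →+* F, ∀ i, φ ⟨x i, apply_mem x i⟩ = v i := by
  let := (ofMvPolynomial x).toAlgebra
  have := isLocalization hx
  have hu : IsUnit ((MvPolynomial.aeval v : MvPolynomial ι ℤ →ₐ[ℤ] F).toRingHom
      (∏ i, MvPolynomial.X i)) := by
    rw [map_prod, isUnit_iff_ne_zero, Finset.prod_ne_zero_iff]
    intro i _
    simpa using hv i
  refine ⟨IsLocalization.Away.lift (∏ i, MvPolynomial.X i : MvPolynomial ι ℤ) hu, fun i => ?_⟩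
  have h := IsLocalization.Away.lift_eq (S := laurentRing x)
    (∏ i, MvPolynomial.X i : MvPolynomial ι ℤ) hu (MvPolynomial.X i)
  have h2 : algebraMap (MvPolynomial ι ℤ) (laurentRing x) (MvPolynomial.X i) =
      ⟨x i, apply_mem x i⟩ := Subtype.ext (by
    rw [show algebraMap (MvPolynomial ι ℤ) (laurentRing x) = ofMvPolynomial x from rfl,
      coe_ofMvPolynomial, MvPolynomial.aeval_X])
  rw [h2] at h
  simpa using h

end laurentRing

/-! ### Mutation of quivers and seeds -/

namespace IceQuiver

variable {ι : Type u}

theorem ext' {Q Q' : IceQuiver ι} (h : ∀ i j, Q.arrows i j = Q'.arrows i j)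
    (hf : Q.frozen = Q'.frozen) : Q = Q' := by
  obtain ⟨a, s, f⟩ := Q
  obtain ⟨a', s', f'⟩ := Q'
  obtain rfl : a = a' := funext fun i => funext fun j => h i j
  obtain rfl : f = f' := hf
  rfl

theorem arrows_self (Q : IceQuiver ι) (i : ι) : Q.arrows i i = 0 := by
  have := Q.skew i i
  omega

/-- The correction term in the mutation rule, in terms of positive and negative parts. -/
theorem abs_mul_add_mul_abs_ediv_two (a b : ℤ) :
    (|a| * b + a * |b|) / 2 = a.toNat * b.toNat - (-a).toNat * (-b).toNat := by
  rcases le_total 0 a with ha | ha <;> rcases le_total 0 b with hb | hb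
  · rw [abs_of_nonneg ha, abs_of_nonneg hb, Int.toNat_of_nonneg ha, Int.toNat_of_nonneg hb,
      Int.toNat_of_nonpos (neg_nonpos.2 ha)]
    have : a * b + a * b = a * b * 2 := by ring
    rw [this, Int.mul_ediv_cancel _ two_ne_zero]; simp
  · rw [abs_of_nonneg ha, abs_of_nonpos hb, Int.toNat_of_nonpos hb,
      Int.toNat_of_nonpos (neg_nonpos.2 ha)]
    simp
  · rw [abs_of_nonpos ha, abs_of_nonneg hb, Int.toNat_of_nonpos ha,
      Int.toNat_of_nonpos (neg_nonpos.2 hb)]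
    simp
  · rw [abs_of_nonpos ha, abs_of_nonpos hb, Int.toNat_of_nonpos ha,
      Int.toNat_of_nonneg (neg_nonneg.2 ha), Int.toNat_of_nonneg (neg_nonneg.2 hb)]
    have : -a * b + a * -b = -(a * b) * 2 := by ring
    rw [this, Int.mul_ediv_cancel _ two_ne_zero]; simp

variable [DecidableEq ι]

theorem mutate_arrows_left (Q : IceQuiver ι) (k j : ι) :
    (Q.mutate k).arrows k j = -Q.arrows k j := by simp [mutate]

theorem mutate_arrows_right (Q : IceQuiver ι) (k i : ι) :
    (Q.mutate k).arrows i k = -Q.arrows i k := by simp [mutate]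

theorem mutate_arrows (Q : IceQuiver ι) {k i j : ι} (hi : i ≠ k) (hj : j ≠ k) :
    (Q.mutate k).arrows i j = Q.arrows i j + ((Q.arrows i k).toNat * (Q.arrows k j).toNat -
      (-Q.arrows i k).toNat * (-Q.arrows k j).toNat) := by
  simp only [mutate, hi, hj, or_self, if_false, abs_mul_add_mul_abs_ediv_two]

/-- Vertices not joined to `k` keep their arrows under mutation at `k`. -/
theorem mutate_arrows_of_eq_zero (Q : IceQuiver ι) {k i : ι} (hi : i ≠ k)
    (h : Q.arrows i k = 0) (j : ι) : (Q.mutate k).arrows i j = Q.arrows i j := by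
  by_cases hj : j = k
  · rw [hj, mutate_arrows_right, h, neg_zero]
  · rw [mutate_arrows Q hi hj, h]; simp

@[simp]
theorem mutate_mutate (Q : IceQuiver ι) (k : ι) : (Q.mutate k).mutate k = Q := by
  refine ext' (fun i j => ?_) rfl
  by_cases hi : i = k
  · rw [hi, mutate_arrows_left, mutate_arrows_left, neg_neg]
  · by_cases hj : j = k
    · rw [hj, mutate_arrows_right, mutate_arrows_right, neg_neg]
    · rw [mutate_arrows _ hi hj, mutate_arrows _ hi hj, mutate_arrows_left, mutate_arrows_right,
        neg_neg, neg_neg]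
      ring

end IceQuiver

namespace ClusterSeed

variable {ι : Type u}

theorem ext' {s t : ClusterSeed ι} (hq : s.quiver = t.quiver) (hc : s.cluster = t.cluster) :
    s = t := by
  obtain ⟨q, c⟩ := s
  obtain ⟨q', c'⟩ := t
  obtain rfl : q = q' := hq
  obtain rfl : c = c' := hc
  rfl

variable [Fintype ι]

/-- The exchange binomial at the vertex `k`: the product of `a_k` with its mutation. -/
noncomputable def exchange (s : ClusterSeed ι) (k : ι) : RationalFunctions ι :=
  ∏ j, s.cluster j ^ (s.quiver.arrows k j).toNat +
    ∏ j, s.cluster j ^ (-s.quiver.arrows k j).toNat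

/-- The exchange binomial at `i` depends on the neighbours of `i` and their variables only. -/
theorem exchange_congr {s t : ClusterSeed ι} {i : ι}
    (hq : ∀ j, s.quiver.arrows i j = t.quiver.arrows i j)
    (hc : ∀ j, s.quiver.arrows i j ≠ 0 → s.cluster j = t.cluster j) :
    s.exchange i = t.exchange i := by
  unfold exchange
  congr 1 <;>
  · refine Finset.prod_congr rfl fun j _ => ?_
    rw [← hq j]
    by_cases h : s.quiver.arrows i j = 0
    · simp [h]
    · rw [hc j h]

theorem exchange_mem {B : Type*} [SetLike B (RationalFunctions ι)]
    [SubsemiringClass B (RationalFunctions ι)] (s : ClusterSeed ι) (k : ι) (A : B)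
    (h : ∀ j, s.quiver.arrows k j ≠ 0 → s.cluster j ∈ A) : s.exchange k ∈ A := by
  refine add_mem (prod_mem fun j _ => ?_) (prod_mem fun j _ => ?_) <;>
  · by_cases hj : s.quiver.arrows k j = 0
    · simp [hj, one_mem]
    · exact pow_mem (h j hj) _

theorem exchange_ne_zero {s : ClusterSeed ι} (hs : AlgebraicIndependent ℚ s.cluster) (k : ι) :
    s.exchange k ≠ 0 := by
  let p : MvPolynomial ι ℚ := ∏ j, MvPolynomial.X j ^ (s.quiver.arrows k j).toNat +
    ∏ j, MvPolynomial.X j ^ (-s.quiver.arrows k j).toNat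
  have hp : MvPolynomial.aeval s.cluster p = s.exchange k := by
    simp [p, exchange]
  have hp1 : MvPolynomial.eval (fun _ => 1) p = 2 := by
    simp [p]; norm_num
  rw [← hp]
  intro h
  have h0 : p = 0 := hs.eq_zero_of_aeval_eq_zero p h
  rw [h0] at hp1
  simp at hp1

variable [DecidableEq ι]

theorem mutate_cluster_self (s : ClusterSeed ι) (k : ι) :
    (s.mutate k).cluster k = s.exchange k * (s.cluster k)⁻¹ := by
  simp [mutate, exchange]

theorem mutate_cluster_of_ne (s : ClusterSeed ι) {k j : ι} (h : j ≠ k) :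
    (s.mutate k).cluster j = s.cluster j := by
  simp [mutate, h]

theorem exchange_mutate (s : ClusterSeed ι) (k : ι) : (s.mutate k).exchange k = s.exchange k := by
  have h1 : ∀ j, (s.mutate k).cluster j ^ (s.quiver.arrows k j).toNat =
      s.cluster j ^ (s.quiver.arrows k j).toNat := by
    intro j
    by_cases hj : j = k
    · rw [hj, IceQuiver.arrows_self]; simp
    · rw [mutate_cluster_of_ne s hj]
  have h2 : ∀ j, (s.mutate k).cluster j ^ (-s.quiver.arrows k j).toNat =
      s.cluster j ^ (-s.quiver.arrows k j).toNat := by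
    intro j
    by_cases hj : j = k
    · rw [hj, IceQuiver.arrows_self]; simp
    · rw [mutate_cluster_of_ne s hj]
  have h3 : ∀ j, (s.mutate k).quiver.arrows k j = -s.quiver.arrows k j :=
    fun j => IceQuiver.mutate_arrows_left _ _ _
  simp only [exchange, h3, neg_neg, h1, h2]
  rw [add_comm]

/-- Mutation is an involution. -/
theorem mutate_mutate {s : ClusterSeed ι} (hs : AlgebraicIndependent ℚ s.cluster) (k : ι) :
    (s.mutate k).mutate k = s := by
  refine ext' (IceQuiver.mutate_mutate _ _) (funext fun j => ?_)
  by_cases hj : j = k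
  · have h1 := exchange_ne_zero hs k
    rw [hj, mutate_cluster_self, exchange_mutate, mutate_cluster_self, mul_inv, inv_inv,
      mul_inv_cancel_left₀ h1]
  · rw [mutate_cluster_of_ne _ hj, mutate_cluster_of_ne _ hj]

/-- The other variables and the exchange binomial do not involve `a_k`, so replacing `a_k` by its
mutation preserves algebraic independence. -/
theorem algebraicIndependent_mutate {s : ClusterSeed ι} (hs : AlgebraicIndependent ℚ s.cluster)
    (k : ι) : AlgebraicIndependent ℚ (s.mutate k).cluster := by
  rw [AlgebraicIndependent.iff_transcendental_adjoin_image k] at hs ⊢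
  have h1 : (fun j : {j // j ≠ k} => (s.mutate k).cluster j) =
      fun j : {j // j ≠ k} => s.cluster j := funext fun j => mutate_cluster_of_ne s j.2
  have h2 : (s.mutate k).cluster '' {k}ᶜ = s.cluster '' {k}ᶜ :=
    Set.image_congr fun j hj => mutate_cluster_of_ne s hj
  rw [h1, h2, mutate_cluster_self]
  refine ⟨hs.1, fun halg => hs.2 ?_⟩
  have hP : s.exchange k ∈ Algebra.adjoin ℚ (s.cluster '' {k}ᶜ) := by
    refine s.exchange_mem k _ fun j hj => Algebra.subset_adjoin ⟨j, ?_, rfl⟩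
    rintro rfl
    exact hj (IceQuiver.arrows_self _ _)
  have hP0 : s.exchange k ≠ 0 :=
    exchange_ne_zero ((AlgebraicIndependent.iff_transcendental_adjoin_image k).2 hs) k
  have h3 : IsAlgebraic (Algebra.adjoin ℚ (s.cluster '' {k}ᶜ)) (s.exchange k) :=
    isAlgebraic_algebraMap (⟨_, hP⟩ : Algebra.adjoin ℚ (s.cluster '' {k}ᶜ))
  have h4 : s.cluster k = s.exchange k * (s.exchange k * (s.cluster k)⁻¹)⁻¹ := by
    rw [mul_inv, inv_inv, mul_inv_cancel_left₀ hP0]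
  rw [h4]
  exact h3.mul halg.inv

theorem algebraicIndependent_of_mutationEquiv {s t : ClusterSeed ι}
    (hs : AlgebraicIndependent ℚ s.cluster) (h : MutationEquiv s t) :
    AlgebraicIndependent ℚ t.cluster := by
  induction h with
  | refl => exact hs
  | tail _ h ih =>
    obtain ⟨k, _, rfl⟩ := h
    exact algebraicIndependent_mutate ih k

theorem frozen_eq_of_mutationEquiv {s t : ClusterSeed ι} (h : MutationEquiv s t) :
    t.quiver.frozen = s.quiver.frozen := by
  induction h with
  | refl => rfl
  | tail _ h ih =>
    obtain ⟨k, _, rfl⟩ := h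
    exact ih

theorem mutationEquiv_mutate (s : ClusterSeed ι) {k : ι} (hk : k ∉ s.quiver.frozen) :
    MutationEquiv s (s.mutate k) :=
  Relation.ReflTransGen.single ⟨k, hk, rfl⟩

theorem MutationEquiv.symm {s t : ClusterSeed ι} (hs : AlgebraicIndependent ℚ s.cluster)
    (h : MutationEquiv s t) : MutationEquiv t s := by
  induction h with
  | refl => exact Relation.ReflTransGen.refl
  | tail h h' ih =>
    obtain ⟨k, hk, rfl⟩ := h'
    refine Relation.ReflTransGen.trans (Relation.ReflTransGen.single ⟨k, hk, ?_⟩) ih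
    rw [mutate_mutate (algebraicIndependent_of_mutationEquiv hs h)]

/-- The seeds of the freezing are freezings of seeds. -/
theorem MutationEquiv.exists_of_freeze {s t : ClusterSeed ι} {S : Set ι}
    (h : MutationEquiv (s.freeze S) t) : ∃ u, MutationEquiv s u ∧ t = u.freeze S := by
  induction h with
  | refl => exact ⟨s, Relation.ReflTransGen.refl, rfl⟩
  | tail _ h ih =>
    obtain ⟨k, hk, rfl⟩ := h
    obtain ⟨u, hu, rfl⟩ := ih
    exact ⟨u.mutate k, hu.tail ⟨k, fun h => hk (Or.inl h), rfl⟩, rfl⟩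

end ClusterSeed

/-! ### Prime elements and the three-mutation argument -/

namespace laurentRing

variable {ι K : Type*} [Field K] {x : ι → K}

theorem isUnit_apply (hx0 : ∀ i, x i ≠ 0) (i : ι) :
    IsUnit (⟨x i, apply_mem x i⟩ : laurentRing x) :=
  IsUnit.of_mul_eq_one ⟨(x i)⁻¹, inv_mem x i⟩ (Subtype.ext (mul_inv_cancel₀ (hx0 i)))

theorem prod_inv_mem (x : ι → K) (s : Finset ι) (f : ι → ℕ) :
    (∏ l ∈ s, x l ^ f l)⁻¹ ∈ laurentRing x := by
  rw [← Finset.prod_inv_distrib]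
  refine Subring.prod_mem _ fun l _ => ?_
  rw [← inv_pow]
  exact Subring.pow_mem _ (inv_mem x l) _

theorem prod_mem (x : ι → K) (s : Finset ι) (f : ι → ℕ) :
    ∏ l ∈ s, x l ^ f l ∈ laurentRing x :=
  Subring.prod_mem _ fun l _ => Subring.pow_mem _ (apply_mem x l) _

end laurentRing

/-- An element generating the kernel of a homomorphism to a field is prime. -/
theorem prime_of_forall_dvd {T F : Type*} [CommRing T] [Field F] (φ : T →+* F) {P : T}
    (hP : P ≠ 0) (hφ : φ P = 0) (h : ∀ f, φ f = 0 → P ∣ f) : Prime P := by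
  refine ⟨hP, fun hu => (hu.map φ).ne_zero hφ, fun a b ⟨c, hc⟩ => ?_⟩
  have : φ a * φ b = 0 := by rw [← map_mul, hc, map_mul, hφ, zero_mul]
  exact (mul_eq_zero.1 this).imp (h a) (h b)

theorem AlgebraicIndependent.int_of_rat {ι K : Type*} [Field K] [Algebra ℚ K] {x : ι → K}
    (hx : AlgebraicIndependent ℚ x) : AlgebraicIndependent ℤ x :=
  hx.restrictScalars (algebraMap ℤ ℚ).injective_int

/-- A binomial in which the variable `y` occurs in one of the two monomials, with exponent one, is a
prime element of the ring of Laurent polynomials: modulo it, `y` becomes a Laurent monomial in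
the other variables, so that the quotient is again a ring of Laurent polynomials. -/
theorem laurentRing.prime_binomial {ι K : Type*} [Field K] [Fintype ι] [DecidableEq ι] {x : ι → K}
    (hx : AlgebraicIndependent ℤ x) (y : ι) (a b : ι → ℕ) {P : K} (hPm : P ∈ laurentRing x)
    (hP0 : P ≠ 0) (hP : P = x y * ∏ l ∈ Finset.univ.erase y, x l ^ a l +
      ∏ l ∈ Finset.univ.erase y, x l ^ b l) :
    Prime (⟨P, hPm⟩ : laurentRing x) := by
  have hx0 : ∀ l, x l ≠ 0 := laurentRing.ne_zero_of_algebraicIndependent hx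
  set A := ∏ l ∈ Finset.univ.erase y, x l ^ a l with hA
  set B := ∏ l ∈ Finset.univ.erase y, x l ^ b l with hB
  have hA0 : A ≠ 0 := Finset.prod_ne_zero_iff.2 fun l _ => pow_ne_zero _ (hx0 l)
  have hB0 : B ≠ 0 := Finset.prod_ne_zero_iff.2 fun l _ => pow_ne_zero _ (hx0 l)
  have hAm : A ∈ laurentRing x := laurentRing.prod_mem _ _ _
  have hBm : B ∈ laurentRing x := laurentRing.prod_mem _ _ _
  have hAi : A⁻¹ ∈ laurentRing x := laurentRing.prod_inv_mem _ _ _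
  have hBi : B⁻¹ ∈ laurentRing x := laurentRing.prod_inv_mem _ _ _
  obtain ⟨φ, hφ⟩ := laurentRing.exists_ringHom (hx)
    (Function.update x y (-B * A⁻¹)) (by
      intro l
      by_cases hl : l = y
      · rw [hl, Function.update_self]
        exact mul_ne_zero (neg_ne_zero.2 hB0) (inv_ne_zero hA0)
      · rw [Function.update_of_ne hl]; exact hx0 l)
  have hφy : φ ⟨x y, laurentRing.apply_mem x y⟩ = -B * A⁻¹ := by rw [hφ, Function.update_self]
  have hφl : ∀ l ≠ y, φ ⟨x l, laurentRing.apply_mem x l⟩ = x l := fun l hl => by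
    rw [hφ, Function.update_of_ne hl]
  have hφM : ∀ (f : ι → ℕ), φ ⟨∏ l ∈ Finset.univ.erase y, x l ^ f l, laurentRing.prod_mem _ _ _⟩ =
      ∏ l ∈ Finset.univ.erase y, x l ^ f l := by
    intro f
    have : (⟨∏ l ∈ Finset.univ.erase y, x l ^ f l, laurentRing.prod_mem _ _ _⟩ : laurentRing x) =
        ∏ l ∈ Finset.univ.erase y, ⟨x l, laurentRing.apply_mem x l⟩ ^ f l :=
      Subtype.ext (by simp)
    rw [this, map_prod]
    refine Finset.prod_congr rfl fun l hl => ?_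
    rw [map_pow, hφl l (Finset.ne_of_mem_erase hl)]
  have hφinv : ∀ l, φ ⟨(x l)⁻¹, laurentRing.inv_mem x l⟩ =
      (φ ⟨x l, laurentRing.apply_mem x l⟩)⁻¹ := by
    intro l
    refine eq_inv_of_mul_eq_one_left ?_
    rw [← map_mul, ← map_one φ]
    congr 1
    exact Subtype.ext (inv_mul_cancel₀ (hx0 l))
  have hφP : φ ⟨P, hPm⟩ = 0 := by
    have : (⟨P, hPm⟩ : laurentRing x) =
        ⟨x y, laurentRing.apply_mem x y⟩ * ⟨A, hAm⟩ + ⟨B, hBm⟩ := Subtype.ext hP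
    rw [this, map_add, map_mul, hφy]
    have h1 : φ ⟨A, hAm⟩ = A := hφM _
    have h2 : φ ⟨B, hBm⟩ = B := hφM _
    rw [h1, h2]
    field_simp
    ring
  -- `φ` is a retraction modulo the binomial.
  have key : ∀ f (hf : f ∈ laurentRing x), ∃ g ∈ laurentRing x,
      f - φ ⟨f, hf⟩ = P * g := by
    intro f hf
    induction hf using Subring.closure_induction with
    | mem f hf =>
      obtain ⟨l, rfl | rfl⟩ := hf
      · by_cases hl : l = y
        · subst hl
          refine ⟨A⁻¹, hAi, ?_⟩
          rw [hφy, hP]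
          field_simp
          ring
        · exact ⟨0, zero_mem _, by rw [hφl l hl]; ring⟩
      · by_cases hl : l = y
        · subst hl
          refine ⟨(x l)⁻¹ * B⁻¹, mul_mem (laurentRing.inv_mem x l) hBi, ?_⟩
          rw [hφinv, hφy, hP]
          have := hx0 l
          field_simp
          ring
        · exact ⟨0, zero_mem _, by rw [hφinv, hφl l hl]; ring⟩
    | zero =>
      refine ⟨0, zero_mem _, ?_⟩
      have : φ ⟨0, zero_mem _⟩ = 0 := map_zero φ
      rw [this]; ring
    | one =>
      refine ⟨0, zero_mem _, ?_⟩
      have : φ ⟨1, one_mem _⟩ = 1 := map_one φ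
      rw [this]; ring
    | add f g hf hg hf' hg' =>
      obtain ⟨u, hu, hu'⟩ := hf'
      obtain ⟨v, hv, hv'⟩ := hg'
      refine ⟨u + v, add_mem hu hv, ?_⟩
      have : φ ⟨f + g, add_mem hf hg⟩ = φ ⟨f, hf⟩ + φ ⟨g, hg⟩ := map_add φ ⟨f, hf⟩ ⟨g, hg⟩
      rw [this]
      linear_combination hu' + hv'
    | neg f hf hf' =>
      obtain ⟨u, hu, hu'⟩ := hf'
      refine ⟨-u, neg_mem hu, ?_⟩
      have : φ ⟨-f, neg_mem hf⟩ = -φ ⟨f, hf⟩ := map_neg φ ⟨f, hf⟩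
      rw [this]
      linear_combination -hu'
    | mul f g hf hg hf' hg' =>
      obtain ⟨u, hu, hu'⟩ := hf'
      obtain ⟨v, hv, hv'⟩ := hg'
      refine ⟨u * g + (f - P * u) * v, add_mem (mul_mem hu hg) (mul_mem (sub_mem hf
        (mul_mem (hPm) hu)) hv), ?_⟩
      have : φ ⟨f * g, mul_mem hf hg⟩ = φ ⟨f, hf⟩ * φ ⟨g, hg⟩ := map_mul φ ⟨f, hf⟩ ⟨g, hg⟩
      rw [this]
      linear_combination g * hu' + φ ⟨f, hf⟩ * hv' - P * v * hu'
  refine prime_of_forall_dvd φ (fun h => hP0 (congrArg Subtype.val h)) hφP ?_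
  intro f hf
  obtain ⟨g, hg, hg'⟩ := key f f.2
  refine ⟨⟨g, hg⟩, Subtype.ext ?_⟩
  rw [hf, sub_zero] at hg'
  exact hg'

/-- The numerical core of the coprimality statement for three mutations in two directions `i`, `j`:
`w`, `v`, `z` are the three new variables, `X`, `Z` are `a_i`, `a_j`, and `A`, `B`, `C`, `D`, `G`
are monomials in the other variables. A homomorphism that kills `w`, but no initial variable,
kills neither `v` nor `z` as soon as it takes the value `2` at `X` and `±1` elsewhere. -/
theorem map_ne_zero_of_three_mutations {T : Type*} [CommRing T] (ψ : T →+* ℚ)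
    {X Z A B C D G w v z : T} {c : ℕ} (hw : w * X = Z ^ c * A + B) (hv : v * Z = w ^ c * C + D)
    (hz : z * (B * Z ^ c) = G * (B * (w ^ (c - 1) * C * ∑ k ∈ Finset.range c,
      (w ^ c * C + D) ^ k * D ^ (c - 1 - k)) + D ^ c * X))
    (hX : ψ X = 2) (hZ : ψ Z = 1) (hAB : ψ A + ψ B = 0) (hB : ψ B = 1 ∨ ψ B = -1)
    (hC : ψ C = 1 ∨ ψ C = -1) (hD : ψ D = 1 ∨ ψ D = -1) (hCD : c = 0 → ψ C = 1 ∧ ψ D = 1)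
    (hG : ψ G ≠ 0) : ψ w = 0 ∧ ψ v ≠ 0 ∧ ψ z ≠ 0 := by
  have hw' := congrArg ψ hw
  have hv' := congrArg ψ hv
  have hz' := congrArg ψ hz
  simp only [map_mul, map_add, map_pow, map_sum, hX, hZ, one_pow, one_mul, mul_one] at hw' hv' hz'
  have hw0 : ψ w = 0 := by linarith
  rw [hw0] at hv' hz'
  refine ⟨hw0, ?_, ?_⟩
  · rw [hv']
    rcases Nat.eq_zero_or_pos c with rfl | hc
    · rw [(hCD rfl).1, (hCD rfl).2]; norm_num
    · rw [zero_pow hc.ne']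
      rcases hD with h | h <;> rw [h] <;> norm_num
  · intro h
    rw [h, zero_mul, eq_comm] at hz'
    have h2 := (mul_eq_zero.1 hz').resolve_left hG
    rcases c with _ | _ | c
    · simp at h2
    · simp at h2
      rcases hB with h | h <;> rcases hC with h' | h' <;> rcases hD with h'' | h'' <;>
        rw [h, h', h''] at h2 <;> norm_num at h2
    · have e : c + 1 + 1 - 1 = c + 1 := rfl
      rw [e, zero_pow (Nat.succ_ne_zero c)] at h2
      have hD0 : ψ D ≠ 0 := by rcases hD with h | h <;> rw [h] <;> norm_num
      have := pow_ne_zero (c + 1 + 1) hD0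
      simp at h2
      exact hD0 h2

namespace ClusterSeed

variable {ι : Type u} [Fintype ι]

theorem exchange_mem_laurentRing (s : ClusterSeed ι) (k : ι) :
    s.exchange k ∈ laurentRing s.cluster :=
  s.exchange_mem k _ fun j _ => laurentRing.apply_mem _ j

variable [DecidableEq ι]

theorem prime_exchange {s : ClusterSeed ι} (hs : AlgebraicIndependent ℚ s.cluster) {i y : ι}
    (hy : s.quiver.arrows i y = 1) :
    Prime (⟨s.exchange i, s.exchange_mem_laurentRing i⟩ : laurentRing s.cluster) := by
  refine laurentRing.prime_binomial hs.int_of_rat y (fun l => (s.quiver.arrows i l).toNat)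
    (fun l => (-s.quiver.arrows i l).toNat) _ (exchange_ne_zero hs i) ?_
  rw [exchange, ← Finset.mul_prod_erase _ _ (Finset.mem_univ y),
      ← Finset.mul_prod_erase _ (fun j => s.cluster j ^ (-s.quiver.arrows i j).toNat)
        (Finset.mem_univ y), hy]
  simp

end ClusterSeed

namespace IceQuiver

variable {ι : Type u}

/-- The quiver with all arrows reversed. -/
def op (Q : IceQuiver ι) : IceQuiver ι where
  arrows i j := -Q.arrows i j
  skew i j := by rw [Q.skew i j]
  frozen := Q.frozen

theorem op_mutate [DecidableEq ι] (Q : IceQuiver ι) (k : ι) : Q.op.mutate k = (Q.mutate k).op := by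
  refine ext' (fun i j => ?_) rfl
  by_cases hi : i = k
  · rw [hi, mutate_arrows_left]
    simp only [op, mutate_arrows_left]
  · by_cases hj : j = k
    · rw [hj, mutate_arrows_right]
      simp only [op, mutate_arrows_right]
    · rw [mutate_arrows _ hi hj]
      simp only [op, mutate_arrows _ hi hj, neg_neg]
      ring

end IceQuiver

namespace ClusterSeed

variable {ι : Type u}

/-- The seed with all arrows reversed. -/
def op (s : ClusterSeed ι) : ClusterSeed ι where
  quiver := s.quiver.op
  cluster := s.cluster

variable [Fintype ι] [DecidableEq ι]

theorem op_mutate (s : ClusterSeed ι) (k : ι) : s.op.mutate k = (s.mutate k).op := by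
  refine ext' (IceQuiver.op_mutate _ _) ?_
  simp only [mutate, op, IceQuiver.op, neg_neg]
  rw [add_comm]

theorem exchange_eq (s : ClusterSeed ι) {i j : ι} (hij : i ≠ j) (k : ι) :
    s.exchange k =
      s.cluster i ^ (s.quiver.arrows k i).toNat * (s.cluster j ^ (s.quiver.arrows k j).toNat *
        ∏ l ∈ (Finset.univ.erase i).erase j, s.cluster l ^ (s.quiver.arrows k l).toNat) +
      s.cluster i ^ (-s.quiver.arrows k i).toNat * (s.cluster j ^ (-s.quiver.arrows k j).toNat *
        ∏ l ∈ (Finset.univ.erase i).erase j, s.cluster l ^ (-s.quiver.arrows k l).toNat) := by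
  have hj : j ∈ Finset.univ.erase i := Finset.mem_erase.2 ⟨hij.symm, Finset.mem_univ j⟩
  rw [exchange, Finset.mul_prod_erase _ (fun l => s.cluster l ^ (s.quiver.arrows k l).toNat) hj,
    Finset.mul_prod_erase _ (fun l => s.cluster l ^ (-s.quiver.arrows k l).toNat) hj,
    Finset.mul_prod_erase _ (fun l => s.cluster l ^ (s.quiver.arrows k l).toNat)
      (Finset.mem_univ i),
    Finset.mul_prod_erase _ (fun l => s.cluster l ^ (-s.quiver.arrows k l).toNat)
      (Finset.mem_univ i)]

/-- The exchange relations for the mutations at `i`, `j`, `i` of a seed with `c ≥ 0` arrows from `i`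
to `j`. The last relation is divided by the variable `w` produced by the first mutation: the right
hand side of `hz` shows that the third new variable `z` is a Laurent polynomial. -/
theorem three_mutations {s : ClusterSeed ι} (hs : AlgebraicIndependent ℚ s.cluster) {i j : ι}
    (hij : i ≠ j) {c : ℕ} (hc : s.quiver.arrows i j = c) {x : ι → RationalFunctions ι}
    (hx : x = s.cluster) (a d : ι → ℤ) (ha : ∀ l, a l = s.quiver.arrows i l)
    (hd : ∀ l, d l = (s.quiver.mutate i).arrows j l) (M : (ι → ℕ) → RationalFunctions ι)
    (hM : ∀ f, M f = ∏ l ∈ (Finset.univ.erase i).erase j, x l ^ f l)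
    {A B C D G w v z : RationalFunctions ι}
    (hA : A = M fun l => (a l).toNat) (hB : B = M fun l => (-a l).toNat)
    (hC : C = M fun l => (d l).toNat) (hD : D = M fun l => (-d l).toNat)
    (hG : G = M fun l => (-(a l + c * (-d l).toNat)).toNat)
    (hw : w = (s.mutate i).cluster i) (hv : v = ((s.mutate i).mutate j).cluster j)
    (hz : z = (((s.mutate i).mutate j).mutate i).cluster i) :
    w * x i = x j ^ c * A + B ∧ v * x j = w ^ c * C + D ∧
      z * (B * x j ^ c) = G * (B * (w ^ (c - 1) * C * ∑ k ∈ Finset.range c,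
        (w ^ c * C + D) ^ k * D ^ (c - 1 - k)) + D ^ c * x i) := by
  subst hx
  have hs1 := algebraicIndependent_mutate hs i
  have hs2 := algebraicIndependent_mutate hs1 j
  have h10 : ∀ l ≠ i, (s.mutate i).cluster l = s.cluster l := fun l hl => mutate_cluster_of_ne s hl
  have h21 : ∀ l ≠ j, ((s.mutate i).mutate j).cluster l = (s.mutate i).cluster l :=
    fun l hl => mutate_cluster_of_ne _ hl
  have hx0 : ∀ l, s.cluster l ≠ 0 := fun l => hs.ne_zero l
  have hw0 : w ≠ 0 := hw ▸ hs1.ne_zero i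
  have hR : ∀ l ∈ (Finset.univ.erase i).erase j, l ≠ i ∧ l ≠ j := fun l hl => by
    rw [Finset.mem_erase, Finset.mem_erase] at hl; exact ⟨hl.2.1, hl.1⟩
  have hM1 : ∀ f : ι → ℕ, ∏ l ∈ (Finset.univ.erase i).erase j, (s.mutate i).cluster l ^ f l = M f :=
    fun f => by
      rw [hM]
      exact Finset.prod_congr rfl fun l hl => by rw [h10 l (hR l hl).1]
  have hM2 : ∀ f : ι → ℕ, ∏ l ∈ (Finset.univ.erase i).erase j,
      ((s.mutate i).mutate j).cluster l ^ f l = M f := fun f => by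
    rw [← hM1]
    exact Finset.prod_congr rfl fun l hl => by rw [h21 l (hR l hl).2]
  have r1 : w * s.cluster i = s.cluster j ^ c * A + B := by
    rw [hw, mutate_cluster_self, inv_mul_cancel_right₀ (hx0 i), exchange_eq s hij,
      IceQuiver.arrows_self, hc, ← hM, ← hM, hA, hB]
    simp [ha]
  have q1 : (s.mutate i).quiver.arrows j i = c := by
    change (s.quiver.mutate i).arrows j i = c
    rw [IceQuiver.mutate_arrows_right, s.quiver.skew j i, neg_neg, hc]
  have q1' : (s.mutate i).quiver.arrows i j = -c := by
    rw [IceQuiver.skew, q1]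
  have r2 : v * s.cluster j = w ^ c * C + D := by
    have h1 : s.cluster j = (s.mutate i).cluster j := (h10 j hij.symm).symm
    rw [hv, mutate_cluster_self, h1, inv_mul_cancel_right₀ (hs1.ne_zero j), exchange_eq _ hij,
      IceQuiver.arrows_self, q1, hM1, hM1, ← hw, hC, hD]
    simp [hd, mutate]
  have r3 : z * w = v ^ c * G + M fun l => (a l + c * (-d l).toNat).toNat := by
    have h1 : w = ((s.mutate i).mutate j).cluster i := by rw [h21 i hij, hw]
    have q2 : ((s.mutate i).mutate j).quiver.arrows i j = c := by
      change ((s.mutate i).quiver.mutate j).arrows i j = c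
      rw [IceQuiver.mutate_arrows_right, q1', neg_neg]
    have q3 : ∀ l, l ≠ i ∧ l ≠ j → ((s.mutate i).mutate j).quiver.arrows i l =
        -(a l + c * (-d l).toNat) := by
      intro l hl
      change ((s.mutate i).quiver.mutate j).arrows i l = _
      rw [IceQuiver.mutate_arrows _ hij hl.2, q1', ha, hd]
      change (s.quiver.mutate i).arrows i l + _ = _
      rw [IceQuiver.mutate_arrows_left]
      simp only [neg_neg, Int.toNat_natCast, Int.toNat_neg_natCast]
      simp only [mutate]
      push_cast
      ring
    rw [hz, mutate_cluster_self, h1, inv_mul_cancel_right₀ (hs2.ne_zero i), exchange_eq _ hij,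
      IceQuiver.arrows_self, q2, hM2, hM2, ← hv, hG]
    have e1 : (M fun l => (((s.mutate i).mutate j).quiver.arrows i l).toNat) =
        M fun l => (-(a l + c * (-d l).toNat)).toNat := by
      rw [hM, hM]
      exact Finset.prod_congr rfl fun l hl => by rw [q3 l (hR l hl)]
    have e2 : (M fun l => (-((s.mutate i).mutate j).quiver.arrows i l).toNat) =
        M fun l => (a l + c * (-d l).toNat).toNat := by
      rw [hM, hM]
      exact Finset.prod_congr rfl fun l hl => by rw [q3 l (hR l hl), neg_neg]
    rw [e1, e2]
    simp
  -- The exponents agree because `n⁺ - n⁻ = n` for the positive and negative parts of an integer.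
  have r4 : G * (A * D ^ c) = (M fun l => (a l + c * (-d l).toNat).toNat) * B := by
    rw [hG, hA, hD, hB]
    simp only [hM]
    rw [← Finset.prod_pow, ← Finset.prod_mul_distrib, ← Finset.prod_mul_distrib,
      ← Finset.prod_mul_distrib]
    refine Finset.prod_congr rfl fun l _ => ?_
    rw [← pow_mul, ← pow_add, ← pow_add, ← pow_add]
    congr 1
    have e : ∀ n : ℤ, (n.toNat : ℤ) - (-n).toNat = n := Int.toNat_sub_toNat_neg
    zify
    have e1 := e (a l + c * (-d l).toNat)
    have e2 := e (a l)
    linear_combination -e1 + e2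
  refine ⟨r1, r2, ?_⟩
  have r5 : (∑ k ∈ Finset.range c, (w ^ c * C + D) ^ k * D ^ (c - 1 - k)) *
      ((w ^ c * C + D) - D) = (w ^ c * C + D) ^ c - D ^ c := Commute.geom_sum₂_mul (Commute.all _ _) c
  set Y := ∑ k ∈ Finset.range c, (w ^ c * C + D) ^ k * D ^ (c - 1 - k) with hY
  have r6 : w ^ (c - 1) * C * Y * w = (w ^ c * C + D) ^ c - D ^ c := by
    rcases Nat.eq_zero_or_pos c with rfl | hc0
    · simp [hY]
    · rw [← r5]
      have : w ^ c = w ^ (c - 1) * w := by rw [← pow_succ]; congr 1; omega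
      rw [this]; ring
  apply mul_right_cancel₀ hw0
  have r7 : (v * s.cluster j) ^ c = v ^ c * s.cluster j ^ c := mul_pow _ _ _
  rw [r2] at r7
  linear_combination B * s.cluster j ^ c * r3 - s.cluster j ^ c * r4 - G * B * r7 -
    G * D ^ c * r1 - G * B * r6

end ClusterSeed

namespace ClusterSeed

variable {ι : Type u} [Fintype ι] [DecidableEq ι]

/-- After mutations at `i`, `j`, `i` the cluster still consists of Laurent polynomials. If moreover a
vertex `y` is joined to `i` by one arrow and not joined to `j`, then no variable of this cluster is
divisible by the variable produced by the first mutation: the evaluation at `y = -1`, `a_i = 2` and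
`1` elsewhere kills the latter only. -/
theorem exists_ringHom_three_mutations_of_nonneg {s : ClusterSeed ι}
    (hs : AlgebraicIndependent ℚ s.cluster) {i j y : ι} (hij : i ≠ j) (hyi : y ≠ i) (hyj : y ≠ j)
    (hc : 0 ≤ s.quiver.arrows i j) (hiy : s.quiver.arrows i y = 1 ∨ s.quiver.arrows i y = -1)
    (hjy : s.quiver.arrows j y = 0) :
    ∃ (h1 : (s.mutate i).cluster i ∈ laurentRing s.cluster)
      (h3 : ∀ l, (((s.mutate i).mutate j).mutate i).cluster l ∈ laurentRing s.cluster)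
      (ψ : laurentRing s.cluster →+* ℚ), ψ ⟨_, h1⟩ = 0 ∧ ∀ l, ψ ⟨_, h3 l⟩ ≠ 0 := by
  set x := s.cluster with hx
  have hx0 : ∀ l, x l ≠ 0 := fun l => hs.ne_zero l
  obtain ⟨c, hc⟩ := Int.eq_ofNat_of_zero_le hc
  obtain ⟨ψ, hψ⟩ := laurentRing.exists_ringHom hs.int_of_rat
    (fun l => if l = i then (2 : ℚ) else if l = y then -1 else 1) (by
      intro l
      split_ifs <;> norm_num)
  set a : ι → ℤ := fun l => s.quiver.arrows i l with ha
  set d : ι → ℤ := fun l => (s.quiver.mutate i).arrows j l with hd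
  set R := (Finset.univ.erase i).erase j with hR
  set M : (ι → ℕ) → RationalFunctions ι := fun f => ∏ l ∈ R, x l ^ f l with hM
  obtain ⟨r1, r2, r3⟩ := three_mutations hs hij hc hx a d (fun _ => rfl) (fun _ => rfl) M
    (fun _ => rfl) rfl rfl rfl rfl rfl rfl rfl rfl
  -- Lift all elements to the ring of Laurent polynomials.
  set X : ι → laurentRing x := fun l => ⟨x l, laurentRing.apply_mem x l⟩ with hX
  set N : (ι → ℕ) → laurentRing x := fun f => ⟨M f, laurentRing.prod_mem x R f⟩ with hN
  set A := N fun l => (a l).toNat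
  set B := N fun l => (-a l).toNat with hB
  set C := N fun l => (d l).toNat
  set D := N fun l => (-d l).toNat
  set G := N fun l => (-(a l + c * (-d l).toNat)).toNat
  have h1 : (s.mutate i).cluster i ∈ laurentRing x := by
    rw [← mul_inv_cancel_right₀ (hx0 i) ((s.mutate i).cluster i), r1]
    exact Subring.mul_mem _ (X j ^ c * A + B).2 (laurentRing.inv_mem x i)
  set w : laurentRing x := ⟨_, h1⟩ with hw
  have h2 : ((s.mutate i).mutate j).cluster j ∈ laurentRing x := by
    rw [← mul_inv_cancel_right₀ (hx0 j) (((s.mutate i).mutate j).cluster j), r2]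
    exact Subring.mul_mem _ (w ^ c * C + D).2 (laurentRing.inv_mem x j)
  have h3 : (((s.mutate i).mutate j).mutate i).cluster i ∈ laurentRing x := by
    have hB0 : (B : RationalFunctions ι) * x j ^ c ≠ 0 :=
      mul_ne_zero (Finset.prod_ne_zero_iff.2 fun l _ => pow_ne_zero _ (hx0 l))
        (pow_ne_zero _ (hx0 j))
    rw [← mul_inv_cancel_right₀ hB0 ((((s.mutate i).mutate j).mutate i).cluster i)]
    have e : (((s.mutate i).mutate j).mutate i).cluster i * ((B : RationalFunctions ι) * x j ^ c) =
        ((G * (B * (w ^ (c - 1) * C * ∑ k ∈ Finset.range c,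
          (w ^ c * C + D) ^ k * D ^ (c - 1 - k)) + D ^ c * X i) : laurentRing x) :
          RationalFunctions ι) := by
      rw [r3]; push_cast; rfl
    rw [e, mul_inv]
    refine Subring.mul_mem _ (Subtype.property _) (Subring.mul_mem _ ?_ ?_)
    · exact laurentRing.prod_inv_mem x R _
    · rw [← inv_pow]; exact Subring.pow_mem _ (laurentRing.inv_mem x j) _
  have hψN : ∀ f : ι → ℕ, ψ (N f) = (-1) ^ f y := by
    intro f
    have e : N f = ∏ l ∈ R, X l ^ f l := Subtype.ext (by simp [hN, hX, hM])
    have hy : y ∈ R := Finset.mem_erase.2 ⟨hyj, Finset.mem_erase.2 ⟨hyi, Finset.mem_univ y⟩⟩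
    rw [e, map_prod, Finset.prod_eq_single_of_mem y hy]
    · rw [map_pow, hψ, if_neg hyi, if_pos rfl]
    · intro l hl hly
      have hli : l ≠ i := Finset.ne_of_mem_erase (Finset.mem_of_mem_erase hl)
      rw [map_pow, hψ, if_neg hli, if_neg hly, one_pow]
  have hsign : ∀ f : ι → ℕ, ψ (N f) = 1 ∨ ψ (N f) = -1 := fun f => by
    rw [hψN]; exact neg_one_pow_eq_or ℚ _
  have hay : a y = 1 ∨ a y = -1 := hiy
  obtain ⟨hw0, hv0, hz0⟩ := map_ne_zero_of_three_mutations ψ (X := X i) (Z := X j) (A := A)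
    (B := B) (C := C) (D := D) (G := G) (w := w) (v := ⟨_, h2⟩) (z := ⟨_, h3⟩) (c := c)
    (Subtype.ext r1) (Subtype.ext r2) (Subtype.ext (by push_cast; exact r3))
    (by rw [hψ, if_pos rfl]) (by rw [hψ, if_neg hij.symm, if_neg hyj.symm])
    (by
      rw [hψN, hψN]
      rcases hay with h | h <;> rw [h] <;> simp)
    (hsign _) (hsign _) (hsign _)
    (by
      -- Without arrows between `i` and `j`, mutation at `i` does not join `y` to `j`.
      intro hc0
      have hji : s.quiver.arrows j i = 0 := by
        rw [s.quiver.skew, hc, hc0]; rfl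
      have hdy : d y = 0 := by
        rw [hd]
        dsimp only
        rw [IceQuiver.mutate_arrows_of_eq_zero _ hij.symm hji, hjy]
      rw [hψN, hψN, hdy]
      simp)
    (by rcases hsign fun l => (-(a l + c * (-d l).toNat)).toNat with h | h <;>
          · rw [h]; norm_num)
  have h3l : ∀ l ≠ i, l ≠ j → (((s.mutate i).mutate j).mutate i).cluster l = x l :=
    fun l hli hlj => by
      rw [mutate_cluster_of_ne _ hli, mutate_cluster_of_ne _ hlj, mutate_cluster_of_ne _ hli]
  have h3j : (((s.mutate i).mutate j).mutate i).cluster j = ((s.mutate i).mutate j).cluster j :=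
    mutate_cluster_of_ne _ hij.symm
  have h3m : ∀ l, (((s.mutate i).mutate j).mutate i).cluster l ∈ laurentRing x := by
    intro l
    by_cases hli : l = i
    · rw [hli]; exact h3
    · by_cases hlj : l = j
      · rw [hlj, h3j]; exact h2
      · rw [h3l l hli hlj]; exact laurentRing.apply_mem x l
  refine ⟨h1, h3m, ψ, hw0, fun l => ?_⟩
  by_cases hli : l = i
  · subst hli; exact hz0
  · by_cases hlj : l = j
    · subst hlj
      rw [show (⟨_, h3m l⟩ : laurentRing x) = ⟨_, h2⟩ from Subtype.ext h3j]
      exact hv0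
    · rw [show (⟨_, h3m l⟩ : laurentRing x) = X l from Subtype.ext (h3l l hli hlj), hψ]
      split_ifs <;> norm_num

theorem exists_ringHom_three_mutations {s : ClusterSeed ι}
    (hs : AlgebraicIndependent ℚ s.cluster) {i j y : ι} (hij : i ≠ j) (hyi : y ≠ i) (hyj : y ≠ j)
    (hiy : s.quiver.arrows i y = 1) (hjy : s.quiver.arrows j y = 0) :
    ∃ (h1 : (s.mutate i).cluster i ∈ laurentRing s.cluster)
      (h3 : ∀ l, (((s.mutate i).mutate j).mutate i).cluster l ∈ laurentRing s.cluster)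
      (ψ : laurentRing s.cluster →+* ℚ), ψ ⟨_, h1⟩ = 0 ∧ ∀ l, ψ ⟨_, h3 l⟩ ≠ 0 := by
  rcases le_total 0 (s.quiver.arrows i j) with hc | hc
  · exact exists_ringHom_three_mutations_of_nonneg hs hij hyi hyj hc (Or.inl hiy) hjy
  · have h := exists_ringHom_three_mutations_of_nonneg (s := s.op) hs hij hyi hyj
      (neg_nonneg.2 hc) (Or.inr (congrArg Neg.neg hiy)) (by simp [op, IceQuiver.op, hjy])
    simp only [op_mutate] at h
    exact h

/-- The step of the proof of the Laurent phenomenon. Let `π` be the product of the cluster of `μ_i s`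
and `u` that of `μ_i μ_j μ_i s`. Then `f = F / πⁿ = H / uᵐ`, where `π` is up to a unit the prime
exchange binomial at `i`, which does not divide `u`. -/
theorem mem_laurentRing_of_three_mutations {s : ClusterSeed ι}
    (hs : AlgebraicIndependent ℚ s.cluster) {i j y : ι} (hij : i ≠ j) (hyi : y ≠ i) (hyj : y ≠ j)
    (hiy : s.quiver.arrows i y = 1) (hjy : s.quiver.arrows j y = 0) {f : RationalFunctions ι}
    (hf1 : f ∈ laurentRing (s.mutate i).cluster)
    (hf3 : f ∈ laurentRing (((s.mutate i).mutate j).mutate i).cluster) :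
    f ∈ laurentRing s.cluster := by
  obtain ⟨h1, h3, ψ, hψ1, hψ3⟩ := exists_ringHom_three_mutations hs hij hyi hyj hiy hjy
  have hs1 := algebraicIndependent_mutate hs i
  have hs3 := algebraicIndependent_mutate (algebraicIndependent_mutate hs1 j) i
  have hx0 : ∀ l, s.cluster l ≠ 0 := fun l => hs.ne_zero l
  have h1m : ∀ l, (s.mutate i).cluster l ∈ laurentRing s.cluster := by
    intro l
    by_cases hli : l = i
    · rw [hli]; exact h1
    · rw [mutate_cluster_of_ne _ hli]; exact laurentRing.apply_mem _ l
  obtain ⟨n, hn⟩ := laurentRing.exists_mul_prod_pow_mem (fun l => hs1.ne_zero l) h1m hf1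
  obtain ⟨m, hm⟩ := laurentRing.exists_mul_prod_pow_mem (fun l => hs3.ne_zero l) h3 hf3
  let p : laurentRing s.cluster := ∏ l, ⟨(s.mutate i).cluster l, h1m l⟩
  let q : laurentRing s.cluster := ∏ l, ⟨(((s.mutate i).mutate j).mutate i).cluster l, h3 l⟩
  have hp : (p : RationalFunctions ι) = ∏ l, (s.mutate i).cluster l := by simp [p]
  have hq : (q : RationalFunctions ι) = ∏ l, (((s.mutate i).mutate j).mutate i).cluster l := by
    simp [q]
  have hp0 : (p : RationalFunctions ι) ≠ 0 := by
    rw [hp]; exact Finset.prod_ne_zero_iff.2 fun l _ => hs1.ne_zero l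
  have hpp : Prime p := by
    let v : laurentRing s.cluster := ⟨(s.cluster i)⁻¹, laurentRing.inv_mem _ i⟩ *
      ∏ l ∈ Finset.univ.erase i, ⟨s.cluster l, laurentRing.apply_mem _ l⟩
    have hv : IsUnit v := by
      refine IsUnit.mul (IsUnit.of_mul_eq_one ⟨s.cluster i, laurentRing.apply_mem _ i⟩
        (Subtype.ext (inv_mul_cancel₀ (hx0 i)))) ?_
      rw [IsUnit.prod_iff]
      exact fun l _ => laurentRing.isUnit_apply hx0 l
    have hpv : p = ⟨s.exchange i, s.exchange_mem_laurentRing i⟩ * v := by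
      refine Subtype.ext ?_
      rw [hp, ← Finset.mul_prod_erase _ _ (Finset.mem_univ i), mutate_cluster_self]
      have : ∏ l ∈ Finset.univ.erase i, (s.mutate i).cluster l =
          ∏ l ∈ Finset.univ.erase i, s.cluster l :=
        Finset.prod_congr rfl fun l hl => mutate_cluster_of_ne s (Finset.ne_of_mem_erase hl)
      rw [this]
      simp [v, mul_assoc]
    rw [hpv, ← (associated_mul_unit_right _ _ hv).prime_iff]
    exact prime_exchange hs hiy
  have hpq : ¬ p ∣ q := by
    rintro ⟨r, hr⟩
    have e1 : ψ p = 0 := by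
      simp only [p, map_prod]
      exact Finset.prod_eq_zero (Finset.mem_univ i) hψ1
    have e2 : ψ q ≠ 0 := by
      simp only [q, map_prod]
      exact Finset.prod_ne_zero_iff.2 fun l _ => hψ3 l
    rw [hr, map_mul, e1, zero_mul] at e2
    exact e2 rfl
  rw [← hp] at hn
  rw [← hq] at hm
  have hpqm : ¬ p ∣ q ^ m := fun h => hpq (hpp.dvd_of_dvd_pow h)
  have hdvd : p ^ n ∣ (⟨_, hn⟩ : laurentRing s.cluster) * q ^ m := by
    refine ⟨⟨_, hm⟩, Subtype.ext ?_⟩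
    push_cast
    ring
  obtain ⟨r, hr⟩ := hpp.pow_dvd_of_dvd_mul_right n hpqm hdvd
  have : f = r := by
    apply mul_right_cancel₀ (pow_ne_zero n hp0)
    have := congrArg Subtype.val hr
    push_cast at this
    rw [this]; ring
  rw [this]
  exact r.2

end ClusterSeed

/-! ### The Laurent phenomenon -/

namespace IceQuiver

variable {ι : Type u} [DecidableEq ι]

/-- The ice quiver with one more vertex `none` and one more arrow, from `i` to `none`. Mutations at
all vertices will be considered, so no vertex is declared frozen. -/
def extend (Q : IceQuiver ι) (i : ι) : IceQuiver (Option ι) where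
  arrows
    | some a, some b => Q.arrows a b
    | some a, none => if a = i then 1 else 0
    | none, some b => if b = i then -1 else 0
    | none, none => 0
  skew := by
    rintro (_ | a) (_ | b)
    · rfl
    · dsimp only; split_ifs <;> rfl
    · dsimp only; split_ifs <;> rfl
    · exact Q.skew a b
  frozen := ∅

end IceQuiver

namespace ClusterSeed

section Words

variable {ι : Type u} [Fintype ι] [DecidableEq ι]

theorem algebraicIndependent_foldl {s : ClusterSeed ι} (hs : AlgebraicIndependent ℚ s.cluster)
    (ks : List ι) : AlgebraicIndependent ℚ (ks.foldl mutate s).cluster := by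
  induction ks generalizing s with
  | nil => exact hs
  | cons k ks ih => exact ih (algebraicIndependent_mutate hs k)

theorem MutationEquiv.exists_foldl {s t : ClusterSeed ι} (h : MutationEquiv s t) :
    ∃ ks : List ι, t = ks.foldl mutate s := by
  induction h with
  | refl => exact ⟨[], rfl⟩
  | tail _ h ih =>
    obtain ⟨k, _, rfl⟩ := h
    obtain ⟨ks, rfl⟩ := ih
    exact ⟨ks ++ [k], by simp⟩

/-- The seed `s` on `ι` is the image of the seed `e` on `Option ι` under the ring homomorphism `θ`,
which maps the additional variable to `1`. -/
structure Specializes {T : Subring (RationalFunctions (Option ι))} (θ : T →+* RationalFunctions ι)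
    (e : ClusterSeed (Option ι)) (s : ClusterSeed ι) : Prop where
  arrows : ∀ a b, e.quiver.arrows (some a) (some b) = s.quiver.arrows a b
  mem : ∀ l, e.cluster l ∈ T
  map_some : ∀ a, θ ⟨e.cluster (some a), mem _⟩ = s.cluster a
  map_none : θ ⟨e.cluster none, mem _⟩ = 1

theorem Specializes.mutate {T : Subring (RationalFunctions (Option ι))}
    {θ : T →+* RationalFunctions ι} {e : ClusterSeed (Option ι)} {s : ClusterSeed ι}
    (h : Specializes θ e s) {k : ι} (he : e.cluster (some k) ≠ 0) (hs : s.cluster k ≠ 0)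
    (hm : ∀ l, (e.mutate (some k)).cluster l ∈ T) :
    Specializes θ (e.mutate (some k)) (s.mutate k) where
  arrows a b := by simp [ClusterSeed.mutate, IceQuiver.mutate, h.arrows]
  mem := hm
  map_some a := by
    by_cases ha : a = k
    · subst ha
      have h1 : (e.mutate (some a)).cluster (some a) * e.cluster (some a) = e.exchange (some a) := by
        rw [mutate_cluster_self, inv_mul_cancel_right₀ he]
      let X : Option ι → T := fun l => ⟨e.cluster l, h.mem l⟩
      have h2 : (⟨(e.mutate (some a)).cluster (some a), hm _⟩ : T) * X (some a) =
          ∏ j, X j ^ (e.quiver.arrows (some a) j).toNat +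
            ∏ j, X j ^ (-e.quiver.arrows (some a) j).toNat :=
        Subtype.ext (by rw [Subring.coe_mul]; exact h1.trans (by simp [exchange, X]))
      have hX : ∀ b, θ (X (some b)) = s.cluster b := h.map_some
      have hX' : θ (X none) = 1 := h.map_none
      have h3 := congrArg θ h2
      simp only [map_mul, map_add, map_prod, map_pow, Fintype.prod_option, hX, hX', one_pow, one_mul,
        h.arrows] at h3
      refine Eq.trans ?_ (mutate_cluster_self s a).symm
      rw [eq_mul_inv_iff_mul_eq₀ hs]
      exact h3
    · rw [mutate_cluster_of_ne s ha, ← h.map_some]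
      congr 1
      exact Subtype.ext (mutate_cluster_of_ne e (by simpa using ha))
  map_none := by
    rw [← h.map_none]
    congr 1

theorem Specializes.foldl {T : Subring (RationalFunctions (Option ι))}
    {θ : T →+* RationalFunctions ι} {e : ClusterSeed (Option ι)} {s : ClusterSeed ι}
    (h : Specializes θ e s) (he : AlgebraicIndependent ℚ e.cluster)
    (hs : AlgebraicIndependent ℚ s.cluster) (ks : List ι)
    (hm : ∀ p, p <+: ks → ∀ l, ((p.map some).foldl ClusterSeed.mutate e).cluster l ∈ T) :
    Specializes θ ((ks.map some).foldl ClusterSeed.mutate e) (ks.foldl ClusterSeed.mutate s) := by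
  induction ks using List.reverseRecOn with
  | nil => exact h
  | append_singleton ks k ih =>
    have h1 := ih fun p hp => hm p (hp.trans (List.prefix_append ks [k]))
    have h2 := hm _ List.prefix_rfl
    rw [List.map_append, List.foldl_append] at h2 ⊢
    rw [List.foldl_append]
    exact h1.mutate ((algebraicIndependent_foldl he _).ne_zero _)
      ((algebraicIndependent_foldl hs _).ne_zero _) h2

end Words

theorem algebraicIndependent_initial {ι : Type u} (Q : IceQuiver ι) :
    AlgebraicIndependent ℚ (initial Q).cluster := by
  rw [algebraicIndependent_iff_injective_aeval]
  have : (MvPolynomial.aeval (initial Q).cluster :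
      MvPolynomial ι ℚ →ₐ[ℚ] RationalFunctions ι) =
      Algebra.algHom ℚ (MvPolynomial ι ℚ) (RationalFunctions ι) := by
    ext i
    simp only [MvPolynomial.aeval_X]
    rfl
  rw [this]
  exact IsFractionRing.injective (MvPolynomial ι ℚ) (RationalFunctions ι)

/-- The Laurent phenomenon, along words of mutations at arbitrary vertices. By induction on the length
of the word `i, j, …`, the variables are Laurent polynomials in the clusters of `μ_i s` and of
`μ_i μ_j μ_i s`. To reach `s` itself, the exchange binomial at `i` has to be prime; this is achieved
by attaching a new vertex to `i`, whose variable is set to `1` in the end. -/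
theorem cluster_foldl_mem_laurentRing (n : ℕ) : ∀ {ι : Type u} [Fintype ι] [DecidableEq ι]
    {s : ClusterSeed ι}, AlgebraicIndependent ℚ s.cluster → ∀ ks : List ι, ks.length = n →
    ∀ l, (ks.foldl mutate s).cluster l ∈ laurentRing s.cluster := by
  induction n using Nat.strong_induction_on with
  | _ n ih =>
  intro ι _ _ s hs ks hks l
  rcases ks with _ | ⟨i, _ | ⟨j, ks⟩⟩
  · exact laurentRing.apply_mem _ l
  · by_cases hl : l = i
    · subst hl
      change (s.mutate l).cluster l ∈ _
      rw [mutate_cluster_self]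
      exact mul_mem (s.exchange_mem_laurentRing l) (laurentRing.inv_mem _ l)
    · change (s.mutate i).cluster l ∈ _
      rw [mutate_cluster_of_ne s hl]
      exact laurentRing.apply_mem _ l
  · simp only [List.length_cons] at hks
    by_cases hij : i = j
    · subst hij
      rw [List.foldl_cons, List.foldl_cons, mutate_mutate hs]
      exact ih ks.length (by omega) hs ks rfl l
    set e : ClusterSeed (Option ι) := initial (s.quiver.extend i) with he_def
    have he : AlgebraicIndependent ℚ e.cluster := algebraicIndependent_initial _
    obtain ⟨θ, hθ⟩ := laurentRing.exists_ringHom he.int_of_rat (fun o => o.elim 1 s.cluster) (by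
      rintro (_ | a)
      · exact one_ne_zero
      · exact hs.ne_zero a)
    have hspec : Specializes θ e s :=
      { arrows := fun a b => rfl
        mem := laurentRing.apply_mem _
        map_some := fun a => hθ (some a)
        map_none := hθ none }
    have hfull : ∀ l, (((i :: j :: ks).map some).foldl mutate e).cluster l ∈
        laurentRing e.cluster := by
      intro l
      have he1 := algebraicIndependent_mutate he (some i)
      have he2 := algebraicIndependent_mutate he1 (some j)
      have he3 := algebraicIndependent_mutate he2 (some i)
      refine mem_laurentRing_of_three_mutations he (i := some i) (j := some j) (y := none)
        (by simpa using hij) (by simp) (by simp) (by simp [he_def, initial, IceQuiver.extend])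
        (by simp [he_def, initial, IceQuiver.extend, Ne.symm hij]) ?_ ?_
      · exact ih (ks.length + 1) (by omega) he1 ((j :: ks).map some) (by simp) l
      · have := ih (ks.length + 1) (by omega) he3 ((i :: ks).map some) (by simp) l
        rw [List.map_cons, List.foldl_cons, mutate_mutate he2] at this
        exact this
    have hpre : ∀ p, p <+: (i :: j :: ks) →
        ∀ l, ((p.map some).foldl mutate e).cluster l ∈ laurentRing e.cluster := by
      intro p hp l
      rcases lt_or_eq_of_le hp.length_le with h | h
      · simp only [List.length_cons] at h
        exact ih p.length (by omega) he (p.map some) (by simp) l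
      · rw [hp.eq_of_length h]
        exact hfull l
    have hfin := hspec.foldl he hs _ hpre
    rw [← hfin.map_some l]
    have hrange : ∀ f (hf : f ∈ laurentRing e.cluster), θ ⟨f, hf⟩ ∈ laurentRing s.cluster := by
      have hgen : ∀ o, θ ⟨e.cluster o, laurentRing.apply_mem _ o⟩ ∈ laurentRing s.cluster ∧
          (θ ⟨e.cluster o, laurentRing.apply_mem _ o⟩)⁻¹ ∈ laurentRing s.cluster := by
        rintro (_ | a)
        · rw [hspec.map_none, inv_one]; exact ⟨one_mem _, one_mem _⟩
        · rw [hspec.map_some]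
          exact ⟨laurentRing.apply_mem _ a, laurentRing.inv_mem _ a⟩
      intro f hf
      induction hf using Subring.closure_induction with
      | mem f hf =>
        obtain ⟨o, rfl | rfl⟩ := hf
        · exact (hgen o).1
        · have : θ ⟨(e.cluster o)⁻¹, laurentRing.inv_mem _ o⟩ =
              (θ ⟨e.cluster o, laurentRing.apply_mem _ o⟩)⁻¹ := by
            refine eq_inv_of_mul_eq_one_left ?_
            rw [← map_mul, ← map_one θ]
            congr 1
            exact Subtype.ext (inv_mul_cancel₀ (he.ne_zero o))
          rw [this]
          exact (hgen o).2
      | zero => exact (map_zero θ).symm ▸ zero_mem _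
      | one => exact (map_one θ).symm ▸ one_mem _
      | add f g hf hg hf' hg' =>
        exact (map_add θ ⟨f, hf⟩ ⟨g, hg⟩).symm ▸ add_mem hf' hg'
      | neg f hf hf' => exact (map_neg θ ⟨f, hf⟩).symm ▸ neg_mem hf'
      | mul f g hf hg hf' hg' =>
        exact (map_mul θ ⟨f, hf⟩ ⟨g, hg⟩).symm ▸ mul_mem hf' hg'
    exact hrange _ _

variable {ι : Type u} [Fintype ι] [DecidableEq ι]

/-- The Laurent phenomenon. -/
theorem MutationEquiv.cluster_mem_laurentRing {s t : ClusterSeed ι} (h : MutationEquiv s t)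
    (hs : AlgebraicIndependent ℚ s.cluster) (l : ι) : t.cluster l ∈ laurentRing s.cluster := by
  obtain ⟨ks, rfl⟩ := h.exists_foldl
  exact cluster_foldl_mem_laurentRing _ hs ks rfl l

end ClusterSeed

/-! ### Rings generated by pairs `a`, `P / a` -/

section ExchangeRing

variable {ι K : Type*} [Field K]

/-- The ring generated by the elements `aᵢ` and `aᵢ' = Pᵢ / aᵢ` for `i ∈ N`. -/
def exchangeRing (a P : ι → K) (N : Set ι) : Subring K :=
  Subring.closure {f | ∃ i ∈ N, f = a i ∨ f = P i * (a i)⁻¹}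

namespace exchangeRing

variable {a P : ι → K} {N : Set ι}

theorem apply_mem {i : ι} (hi : i ∈ N) : a i ∈ exchangeRing a P N :=
  Subring.subset_closure ⟨i, hi, Or.inl rfl⟩

theorem mul_inv_mem {i : ι} (hi : i ∈ N) : P i * (a i)⁻¹ ∈ exchangeRing a P N :=
  Subring.subset_closure ⟨i, hi, Or.inr rfl⟩

theorem congr {a' P' : ι → K} (h : ∀ i ∈ N, a i = a' i ∧ P i = P' i) :
    exchangeRing a P N = exchangeRing a' P' N := by
  unfold exchangeRing
  congr 1
  ext f
  constructor <;> rintro ⟨i, hi, hf⟩ <;> refine ⟨i, hi, ?_⟩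
  · rwa [← (h i hi).1, ← (h i hi).2]
  · rwa [(h i hi).1, (h i hi).2]

theorem insert (a P : ι → K) (N : Set ι) (i : ι) :
    exchangeRing a P (insert i N) =
      Subring.closure ((exchangeRing a P N : Set K) ∪ {a i, P i * (a i)⁻¹}) := by
  apply le_antisymm
  · refine Subring.closure_le.2 ?_
    rintro f ⟨j, rfl | hj, rfl | rfl⟩
    · exact Subring.subset_closure (by simp)
    · exact Subring.subset_closure (by simp)
    · exact Subring.subset_closure (Or.inl (apply_mem hj))
    · exact Subring.subset_closure (Or.inl (mul_inv_mem hj))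
  · refine Subring.closure_le.2 ?_
    rintro f (hf | rfl | rfl)
    · refine Subring.closure_mono ?_ hf
      rintro g ⟨j, hj, hg⟩
      exact ⟨j, Or.inr hj, hg⟩
    · exact apply_mem (Set.mem_insert i N)
    · exact mul_inv_mem (Set.mem_insert i N)

theorem finiteType [Finite ι] (a P : ι → K) (N : Set ι) :
    Algebra.FiniteType ℤ (exchangeRing a P N) := by
  have hfin : {f | ∃ i ∈ N, f = a i ∨ f = P i * (a i)⁻¹}.Finite := by
    refine ((Set.finite_range a).union (Set.finite_range fun i => P i * (a i)⁻¹)).subset ?_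
    rintro f ⟨i, _, rfl | rfl⟩
    · exact Or.inl ⟨i, rfl⟩
    · exact Or.inr ⟨i, rfl⟩
  have h : (subalgebraOfSubring (exchangeRing a P N)).FG := by
    refine ⟨hfin.toFinset, le_antisymm (Algebra.adjoin_le ?_) ?_⟩
    · rw [hfin.coe_toFinset]
      exact Subring.subset_closure
    · intro f hf
      have : exchangeRing a P N ≤ (Algebra.adjoin ℤ (hfin.toFinset : Set K)).toSubring := by
        refine Subring.closure_le.2 ?_
        rw [hfin.coe_toFinset]
        exact Algebra.subset_adjoin
      exact this hf
  exact (Subalgebra.fg_iff_finiteType _).1 h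

/-- If the `Pⱼ`, `j ∈ N`, do not involve the variable `aᵢ`, where `i ∉ N`, then this variable is
transcendental over the ring generated by the `aⱼ` and `Pⱼ / aⱼ` for `j ∈ N`. -/
theorem transcendental [Algebra ℚ K] (ha : AlgebraicIndependent ℚ a) {i : ι} (hi : i ∉ N)
    (hP : ∀ j ∈ N, P j ∈ IntermediateField.adjoin ℚ (a '' {i}ᶜ)) :
    Transcendental (exchangeRing a P N) (a i) := by
  have h1 : Transcendental (Algebra.adjoin ℚ (a '' {i}ᶜ)) (a i) :=
    ha.transcendental_adjoin (by simp)
  open scoped IntermediateField.algebraAdjoinAdjoin in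
  have h2 : Transcendental (IntermediateField.adjoin ℚ (a '' {i}ᶜ)) (a i) := fun h =>
    h1 ((IsFractionRing.isAlgebraic_iff (Algebra.adjoin ℚ (a '' {i}ᶜ))
      (IntermediateField.adjoin ℚ (a '' {i}ᶜ)) K).2 h)
  have hle : exchangeRing a P N ≤ (IntermediateField.adjoin ℚ (a '' {i}ᶜ)).toSubfield.toSubring := by
    refine Subring.closure_le.2 ?_
    have hmem : ∀ j ∈ N, a j ∈ IntermediateField.adjoin ℚ (a '' {i}ᶜ) := fun j hj =>
      IntermediateField.subset_adjoin _ _ ⟨j, fun h => hi (h ▸ hj), rfl⟩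
    rintro f ⟨j, hj, rfl | rfl⟩
    · exact hmem j hj
    · exact IntermediateField.mul_mem _ (hP j hj) (IntermediateField.inv_mem _ (hmem j hj))
  let : Algebra (exchangeRing a P N) (IntermediateField.adjoin ℚ (a '' {i}ᶜ)) :=
    (Subring.inclusion hle).toAlgebra
  have : IsScalarTower (exchangeRing a P N) (IntermediateField.adjoin ℚ (a '' {i}ᶜ)) K :=
    IsScalarTower.of_algebraMap_eq fun _ => rfl
  exact h2.restrictScalars (Subring.inclusion_injective hle)

theorem isCompleteIntersectionRing_empty {K : Type u} [Field K] [CharZero K] (a P : ι → K) :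
    IsCompleteIntersectionRing (exchangeRing a P ∅) := by
  have h : exchangeRing a P ∅ = (Int.castRingHom K).range := by
    simp only [exchangeRing, Set.mem_empty_iff_false, false_and, exists_false, Set.ofPred_false,
      Subring.closure_empty]
    rfl
  let e : ℤ ≃+* exchangeRing a P ∅ :=
    (RingEquiv.ofBijective (Int.castRingHom K).rangeRestrict
      ⟨fun m n hmn => Int.cast_injective (α := K) (congrArg Subtype.val hmn),
        (Int.castRingHom K).rangeRestrict_surjective⟩).trans (RingEquiv.subringCongr h.symm)
  refine ⟨exchangeRing a P ∅, inferInstance, IsRegularRing.of_ringEquiv e, [],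
    RingTheory.Sequence.IsRegular.nil _ _, ⟨?_⟩⟩
  exact (RingEquiv.quotientBot _).symm.trans (Ideal.quotEquivOfEq (Ideal.ofList_nil).symm)

end exchangeRing

end ExchangeRing

/-! ### Isolated seeds -/

namespace IceQuiver

variable {ι : Type u}

/-- There are no arrows between mutable vertices. -/
def IsIsolated (Q : IceQuiver ι) : Prop :=
  ∀ i ∉ Q.frozen, ∀ j ∉ Q.frozen, Q.arrows i j = 0

theorem IsIsolated.freeze {Q : IceQuiver ι} (h : Q.IsIsolated) (S : Set ι) :
    (Q.freeze S).IsIsolated :=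
  fun i hi j hj => h i (fun h => hi (Or.inl h)) j fun h => hj (Or.inl h)

theorem IsIsolated.mutate [DecidableEq ι] {Q : IceQuiver ι} (h : Q.IsIsolated) {k : ι}
    (hk : k ∉ Q.frozen) : (Q.mutate k).IsIsolated := by
  intro i hi j hj
  by_cases hik : i = k
  · rw [hik, mutate_arrows_left, h k hk j hj, neg_zero]
  · rw [mutate_arrows_of_eq_zero _ hik (h i hi k hk), h i hi j hj]

end IceQuiver

namespace ClusterSeed

variable {ι : Type u} [Fintype ι]

open Classical in
/-- The product `a_i a_i'` in the cluster algebra, where `a_i'` is the mutation of `a_i` if `i` is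
mutable, and the inverse of `a_i` if `i` is frozen. -/
noncomputable def numerator (s : ClusterSeed ι) (i : ι) : RationalFunctions ι :=
  if i ∈ s.quiver.frozen then 1 else s.exchange i

theorem numerator_of_mem (s : ClusterSeed ι) {i : ι} (hi : i ∈ s.quiver.frozen) :
    s.numerator i = 1 := if_pos hi

theorem numerator_of_notMem (s : ClusterSeed ι) {i : ι} (hi : i ∉ s.quiver.frozen) :
    s.numerator i = s.exchange i := if_neg hi

/-- The lower bound of a cluster algebra: the ring generated by the variables of one seed, their
mutations, and the inverses of the frozen variables. -/
noncomputable def lowerBound (s : ClusterSeed ι) : Subring (RationalFunctions ι) :=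
  exchangeRing s.cluster s.numerator Set.univ

theorem numerator_mem_of_isIsolated {s : ClusterSeed ι} (hq : s.quiver.IsIsolated)
    {B : Type*} [SetLike B (RationalFunctions ι)] [SubsemiringClass B (RationalFunctions ι)] (A : B)
    (i : ι) (hA : i ∉ s.quiver.frozen → ∀ j ∈ s.quiver.frozen, s.cluster j ∈ A) :
    s.numerator i ∈ A := by
  by_cases hi : i ∈ s.quiver.frozen
  · rw [numerator_of_mem s hi]; exact one_mem A
  · rw [numerator_of_notMem s hi]
    refine s.exchange_mem i A fun j hj => hA hi j ?_
    by_contra hj'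
    exact hj (hq i hi j hj')

theorem transcendental_of_isIsolated {s : ClusterSeed ι} (hs : AlgebraicIndependent ℚ s.cluster)
    (hq : s.quiver.IsIsolated) {N : Set ι} {i : ι} (hi : i ∉ N)
    (hN : ∀ j ∈ N, j ∉ s.quiver.frozen → i ∉ s.quiver.frozen) :
    Transcendental (exchangeRing s.cluster s.numerator N) (s.cluster i) := by
  refine exchangeRing.transcendental hs hi fun j hj =>
    numerator_mem_of_isIsolated hq _ j fun hj' l hl => ?_
  exact IntermediateField.subset_adjoin _ _ ⟨l, fun h => hN j hj hj' (h ▸ hl), rfl⟩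

theorem numerator_ne_zero {s : ClusterSeed ι} (hs : AlgebraicIndependent ℚ s.cluster) (i : ι) :
    s.numerator i ≠ 0 := by
  unfold numerator
  split_ifs
  · exact one_ne_zero
  · exact exchange_ne_zero hs i

variable [DecidableEq ι]

/-- The frozen vertices are treated as pairs `a_i`, `a_i'` with `a_i a_i' = 1`; they come before the
mutable vertices, whose exchange binomials involve frozen variables only. -/
theorem isCompleteIntersectionRing_lowerBound {s : ClusterSeed ι}
    (hs : AlgebraicIndependent ℚ s.cluster) (hq : s.quiver.IsIsolated) :
    IsCompleteIntersectionRing s.lowerBound := by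
  classical
  have : CharZero (RationalFunctions ι) := algebraRat.charZero _
  have step : ∀ (N : Set ι) (i : ι), i ∉ N → (∀ j ∈ N, j ∉ s.quiver.frozen → i ∉ s.quiver.frozen) →
      (i ∉ s.quiver.frozen → s.quiver.frozen ⊆ N) →
      IsCompleteIntersectionRing (exchangeRing s.cluster s.numerator N) →
      IsCompleteIntersectionRing (exchangeRing s.cluster s.numerator (insert i N)) := by
    intro N i hi hN hN' h
    rw [exchangeRing.insert]
    refine h.closure_pair (transcendental_of_isIsolated hs hq hi hN)
      (numerator_mem_of_isIsolated hq _ i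
        fun hif j hj => exchangeRing.apply_mem (hN' hif hj)) (numerator_ne_zero hs i) ?_
    rw [mul_comm, inv_mul_cancel_right₀ (hs.ne_zero i)]
  have frozen : ∀ N : Finset ι, (N : Set ι) ⊆ s.quiver.frozen →
      IsCompleteIntersectionRing (exchangeRing s.cluster s.numerator N) := by
    intro N
    induction N using Finset.induction_on with
    | empty =>
      intro _
      rw [Finset.coe_empty]
      exact exchangeRing.isCompleteIntersectionRing_empty _ _
    | insert i N hi ih =>
      intro h
      rw [Finset.coe_insert, Set.insert_subset_iff] at h
      rw [Finset.coe_insert]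
      exact step N i hi (fun j hj hj' => absurd (h.2 hj) hj') (fun h' => absurd h.1 h') (ih h.2)
  have mutable : ∀ N : Finset ι, Disjoint (N : Set ι) s.quiver.frozen →
      IsCompleteIntersectionRing (exchangeRing s.cluster s.numerator (N ∪ s.quiver.frozen)) := by
    intro N
    induction N using Finset.induction_on with
    | empty =>
      intro _
      have h := frozen s.quiver.frozen.toFinset (by simp)
      rw [Set.coe_toFinset] at h
      rw [Finset.coe_empty, Set.empty_union]
      exact h
    | insert i N hi ih =>
      intro h
      rw [Finset.coe_insert, Set.disjoint_insert_left] at h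
      rw [Finset.coe_insert, Set.insert_union]
      refine step _ i ?_ (fun _ _ _ => h.1) (fun _ => Set.subset_union_right) (ih h.2)
      rintro (h' | h')
      · exact hi h'
      · exact h.1 h'
  have h := mutable (s.quiver.frozenᶜ).toFinset (by simpa using disjoint_compl_left)
  rw [Set.coe_toFinset, Set.compl_union_self] at h
  exact h

/-- An element that is a Laurent polynomial in every cluster of an isolated seed is in the lower
bound. Inductively, freezing a vertex `i` in the seed and in its mutation at `i` shows that the
element is a Laurent polynomial in `a_i` and in `a_i'`, over the same ring. -/
theorem mem_lowerBound_of_forall {s : ClusterSeed ι} (hs : AlgebraicIndependent ℚ s.cluster)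
    (hq : s.quiver.IsIsolated) {f : RationalFunctions ι}
    (hf : ∀ t, MutationEquiv s t → f ∈ laurentRing t.cluster) : f ∈ s.lowerBound := by
  induction hn : (s.quiver.frozenᶜ).ncard generalizing s with
  | zero =>
    rw [Set.ncard_eq_zero, Set.compl_empty_iff] at hn
    refine Subring.closure_mono ?_ (hf s Relation.ReflTransGen.refl)
    rintro g ⟨i, rfl | rfl⟩
    · exact ⟨i, trivial, Or.inl rfl⟩
    · exact ⟨i, trivial, Or.inr (by rw [numerator_of_mem s (hn ▸ trivial), one_mul])⟩
  | succ n ih =>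
    obtain ⟨i, hi⟩ : (s.quiver.frozenᶜ).Nonempty := by
      rw [← Set.ncard_pos, hn]; exact n.succ_pos
    have hi' : i ∉ s.quiver.frozen := hi
    have hcard : ((s.quiver.frozen ∪ {i})ᶜ).ncard = n := by
      rw [Set.compl_union, ← Set.sdiff_eq, Set.ncard_sdiff_singleton_of_mem hi, hn]; rfl
    have h1 : f ∈ (s.freeze {i}).lowerBound := by
      refine ih (s := s.freeze {i}) hs (hq.freeze _) (fun t ht => ?_) hcard
      obtain ⟨u, hu, rfl⟩ := ht.exists_of_freeze
      exact hf u hu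
    have h2 : f ∈ ((s.mutate i).freeze {i}).lowerBound := by
      refine ih (s := (s.mutate i).freeze {i}) (algebraicIndependent_mutate hs i)
        ((hq.mutate hi').freeze _) (fun t ht => ?_) hcard
      obtain ⟨u, hu, rfl⟩ := ht.exists_of_freeze
      exact hf u ((mutationEquiv_mutate s hi').trans hu)
    have huniv : (Set.univ : Set ι) = insert i {i}ᶜ := by
      ext j; simp [em]
    set B := exchangeRing s.cluster s.numerator {i}ᶜ with hB
    have hcl : ∀ j ≠ i, (s.mutate i).cluster j = s.cluster j := fun j hj =>
      mutate_cluster_of_ne s hj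
    have hB1 : exchangeRing (s.freeze {i}).cluster (s.freeze {i}).numerator {i}ᶜ = B := by
      refine exchangeRing.congr fun j hj => ⟨rfl, ?_⟩
      have hj' : j ≠ i := hj
      by_cases hjf : j ∈ s.quiver.frozen
      · rw [numerator_of_mem _ (Or.inl hjf), numerator_of_mem _ hjf]
      · rw [numerator_of_notMem _ (by rintro (h | h); exacts [hjf h, hj h]),
          numerator_of_notMem _ hjf]
        rfl
    have hB2 : exchangeRing ((s.mutate i).freeze {i}).cluster
        ((s.mutate i).freeze {i}).numerator {i}ᶜ = B := by
      refine exchangeRing.congr fun j hj => ⟨hcl j hj, ?_⟩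
      have hj' : j ≠ i := hj
      by_cases hjf : j ∈ s.quiver.frozen
      · rw [numerator_of_mem _ (Or.inl hjf), numerator_of_mem _ hjf]
      · rw [numerator_of_notMem _ (by rintro (h | h); exacts [hjf h, hj h]),
          numerator_of_notMem _ hjf]
        have hji : s.quiver.arrows j i = 0 := hq j hjf i hi'
        change (s.mutate i).exchange j = _
        have hqj : ∀ l, (s.mutate i).quiver.arrows j l = s.quiver.arrows j l :=
          IceQuiver.mutate_arrows_of_eq_zero _ hj' hji
        refine exchange_congr hqj fun l hl => hcl l ?_
        rintro rfl
        exact hl (by rw [hqj, hji])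
    have hn1 : (s.freeze {i}).numerator i = 1 := numerator_of_mem _ (Or.inr rfl)
    have hn2 : ((s.mutate i).freeze {i}).numerator i = 1 := numerator_of_mem _ (Or.inr rfl)
    rw [lowerBound, huniv, exchangeRing.insert, hB1, hn1, one_mul] at h1
    rw [lowerBound, huniv, exchangeRing.insert, hB2, hn2, one_mul] at h2
    rw [lowerBound, huniv, exchangeRing.insert]
    have hci : ((s.mutate i).freeze {i}).cluster i = s.numerator i * (s.cluster i)⁻¹ := by
      rw [numerator_of_notMem s hi']
      exact mutate_cluster_self s i
    rw [hci] at h2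
    refine mem_closure_pair_of_mem_of_mem
      (transcendental_of_isIsolated hs hq (by simp) fun _ _ _ => hi')
      (numerator_mem_of_isIsolated hq _ i fun _ j hj =>
        exchangeRing.apply_mem fun h => hi' (h ▸ hj))
      (numerator_ne_zero hs i) ?_ h1 h2
    rw [mul_comm, inv_mul_cancel_right₀ (hs.ne_zero i)]

theorem MutationEquiv.cluster_eq_of_mem_frozen {s t : ClusterSeed ι} (h : MutationEquiv s t) {i : ι}
    (hi : i ∈ s.quiver.frozen) : t.cluster i = s.cluster i := by
  induction h with
  | refl => rfl
  | tail h h' ih =>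
    obtain ⟨k, hk, rfl⟩ := h'
    rw [mutate_cluster_of_ne, ih]
    rintro rfl
    rw [frozen_eq_of_mutationEquiv h] at hk
    exact hk hi

theorem lowerBound_le_laurentRing {s t : ClusterSeed ι} (hs : AlgebraicIndependent ℚ s.cluster)
    (h : MutationEquiv s t) : s.lowerBound ≤ laurentRing t.cluster := by
  have ht := algebraicIndependent_of_mutationEquiv hs h
  refine Subring.closure_le.2 ?_
  rintro f ⟨i, -, rfl | rfl⟩
  · exact MutationEquiv.cluster_mem_laurentRing (h.symm hs) ht i
  · by_cases hi : i ∈ s.quiver.frozen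
    · rw [numerator_of_mem s hi, one_mul, ← h.cluster_eq_of_mem_frozen hi]
      exact laurentRing.inv_mem _ i
    · rw [numerator_of_notMem s hi, ← mutate_cluster_self]
      exact MutationEquiv.cluster_mem_laurentRing
        ((h.symm hs).trans (mutationEquiv_mutate s hi)) ht i

theorem isIntegrallyClosed_lowerBound {s : ClusterSeed ι} (hs : AlgebraicIndependent ℚ s.cluster)
    (hq : s.quiver.IsIsolated) : IsIntegrallyClosed s.lowerBound :=
  isIntegrallyClosed_of_forall (fun t : {t // MutationEquiv s t} => laurentRing t.1.cluster)
    (fun t => laurentRing.isIntegrallyClosed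
      (algebraicIndependent_of_mutationEquiv hs t.2).int_of_rat)
    (fun t => lowerBound_le_laurentRing hs t.2)
    fun _ hf => mem_lowerBound_of_forall hs hq fun t ht => hf ⟨t, ht⟩

end ClusterSeed

/-! ### Local properties of subrings of a field -/

section LocalProperties

variable {K : Type u} [Field K]

namespace Subring.IsLocalizationAt

variable {A L : Subring K} {f : K}

theorem nonempty_ringEquiv (h : A.IsLocalizationAt L f) :
    Nonempty (Localization.Away (⟨f, h.mem⟩ : A) ≃+* L) := by
  let := (Subring.inclusion h.le).toAlgebra
  have := h.isLocalization
  exact ⟨(IsLocalization.algEquiv (Submonoid.powers (⟨f, h.mem⟩ : A)) _ L).toRingEquiv⟩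

theorem exists_lift (h : A.IsLocalizationAt L f) {F : Type*} [Field F] (χ : A →+* F)
    (hχ : χ ⟨f, h.mem⟩ ≠ 0) :
    ∃ χ' : L →+* F, ∀ a (ha : a ∈ A), χ' ⟨a, h.le ha⟩ = χ ⟨a, ha⟩ := by
  let := (Subring.inclusion h.le).toAlgebra
  have := h.isLocalization
  exact ⟨IsLocalization.Away.lift (⟨f, h.mem⟩ : A) hχ.isUnit, fun a ha =>
    IsLocalization.Away.lift_eq (S := L) (⟨f, h.mem⟩ : A) hχ.isUnit ⟨a, ha⟩⟩

end Subring.IsLocalizationAt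

theorem Algebra.FiniteType.of_forall_prime {A : Subring K}
    (h : ∀ p : PrimeSpectrum A, ∃ (f : A) (L : Subring K), f ∉ p.asIdeal ∧
      A.IsLocalizationAt L f ∧ Algebra.FiniteType ℤ L) : Algebra.FiniteType ℤ A := by
  refine Algebra.FiniteType.of_span_eq_top_target
    {f : A | ∃ L : Subring K, A.IsLocalizationAt L f ∧ Algebra.FiniteType ℤ L} ?_ ?_
  · by_contra hne
    obtain ⟨m, hm, hle⟩ := Ideal.exists_le_maximal _ hne
    obtain ⟨f, L, hf, hL⟩ := h ⟨m, hm.isPrime⟩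
    exact hf (hle (Ideal.subset_span ⟨L, hL⟩))
  · rintro f ⟨L, hL, hfin⟩
    obtain ⟨e⟩ := hL.nonempty_ringEquiv
    let φ : L →ₐ[ℤ] Localization.Away f :=
      { (e.symm : L →+* Localization.Away f) with commutes' := fun n => by simp }
    exact Algebra.FiniteType.of_surjective φ e.symm.surjective

theorem IsIntegrallyClosed.of_forall_prime {A : Subring K}
    (h : ∀ p : PrimeSpectrum A, ∃ (f : A) (L : Subring K), f ∉ p.asIdeal ∧
      A.IsLocalizationAt L f ∧ IsIntegrallyClosed L) : IsIntegrallyClosed A := by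
  rw [isIntegrallyClosed_subring_iff]
  rintro y ⟨b, hb, hb0, hyb⟩ hy
  -- The ideal of denominators of `y`.
  let I : Ideal A :=
    { carrier := {a | y * a ∈ A}
      add_mem' := fun {a b} ha hb => by
        change y * ((a + b : A) : K) ∈ A
        rw [Subring.coe_add, mul_add]
        exact A.add_mem ha hb
      zero_mem' := by
        change y * ((0 : A) : K) ∈ A
        rw [Subring.coe_zero, mul_zero]
        exact A.zero_mem
      smul_mem' := fun c a ha => by
        change y * ((c * a : A) : K) ∈ A
        rw [Subring.coe_mul, mul_left_comm]
        exact A.mul_mem c.2 ha }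
  have hI : I = ⊤ := by
    by_contra hne
    obtain ⟨m, hm, hle⟩ := Ideal.exists_le_maximal _ hne
    obtain ⟨f, L, hf, hL, hLn⟩ := h ⟨m, hm.isPrime⟩
    have hyL : y ∈ L := by
      refine (isIntegrallyClosed_subring_iff L).1 hLn y ⟨b, hL.le hb, hb0, hL.le hyb⟩ ?_
      let := (Subring.inclusion hL.le).toAlgebra
      have : IsScalarTower A L K := IsScalarTower.of_algebraMap_eq fun _ => rfl
      exact hy.tower_top
    obtain ⟨n, hn⟩ := hL.exists_mul_pow_mem y hyL
    exact hf (hm.isPrime.mem_of_pow_mem n (hle (show f ^ n ∈ I by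
      change y * ((f ^ n : A) : K) ∈ A
      rwa [Subring.coe_pow])))
  have h1 : (1 : A) ∈ I := hI ▸ Submodule.mem_top
  have h2 : y * ((1 : A) : K) ∈ A := h1
  rwa [Subring.coe_one, mul_one] at h2

theorem IsCompleteIntersectionRing.of_ringEquiv {A B : Type u} [CommRing A] [CommRing B]
    (e : A ≃+* B) (h : IsCompleteIntersectionRing B) : IsCompleteIntersectionRing A := by
  obtain ⟨R, hR, hreg, rs, hrs, ⟨e'⟩⟩ := h
  exact ⟨R, hR, hreg, rs, hrs, ⟨e.trans e'⟩⟩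

theorem IsLocallyCompleteIntersectionRing.of_forall_prime {A : Subring K}
    (h : ∀ p : PrimeSpectrum A, ∃ (f : A) (L : Subring K), f ∉ p.asIdeal ∧
      A.IsLocalizationAt L f ∧ IsCompleteIntersectionRing L) :
    IsLocallyCompleteIntersectionRing A := by
  intro p
  obtain ⟨f, L, hf, hL, hci⟩ := h p
  obtain ⟨e⟩ := hL.nonempty_ringEquiv
  exact ⟨f, hf, hci.of_ringEquiv e⟩

end LocalProperties

/-! ### Localizations of cluster algebras -/

namespace ClusterSeed

variable {ι : Type u} [Fintype ι]

open Classical in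
/-- The product of the variables at the vertices in `S`. -/
noncomputable def clusterProd (s : ClusterSeed ι) (S : Set ι) : RationalFunctions ι :=
  ∏ j with j ∈ S, s.cluster j

theorem clusterProd_mem (s : ClusterSeed ι) (S : Set ι) {B : Subring (RationalFunctions ι)}
    (h : ∀ j ∈ S, s.cluster j ∈ B) : s.clusterProd S ∈ B := by
  classical
  exact Subring.prod_mem _ fun j hj => h j (Finset.mem_filter.1 hj).2

theorem clusterProd_inv_mem (s : ClusterSeed ι) (S : Set ι) {B : Subring (RationalFunctions ι)}
    (h : ∀ j ∈ S, (s.cluster j)⁻¹ ∈ B) : (s.clusterProd S)⁻¹ ∈ B := by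
  classical
  rw [clusterProd, ← Finset.prod_inv_distrib]
  exact Subring.prod_mem _ fun j hj => h j (Finset.mem_filter.1 hj).2

theorem clusterProd_ne_zero {s : ClusterSeed ι} (hs : AlgebraicIndependent ℚ s.cluster)
    (S : Set ι) : s.clusterProd S ≠ 0 :=
  Finset.prod_ne_zero_iff.2 fun j _ => hs.ne_zero j

theorem inv_mul_clusterProd_mem {s : ClusterSeed ι} (hs : AlgebraicIndependent ℚ s.cluster)
    {S : Set ι} {j : ι} (hj : j ∈ S) {B : Subring (RationalFunctions ι)}
    (h : ∀ j ∈ S, s.cluster j ∈ B) : (s.cluster j)⁻¹ * s.clusterProd S ∈ B := by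
  classical
  rw [clusterProd, ← Finset.mul_prod_erase _ _ (Finset.mem_filter.2 ⟨Finset.mem_univ j, hj⟩),
    inv_mul_cancel_left₀ (hs.ne_zero j)]
  exact Subring.prod_mem _ fun l hl =>
    h l (Finset.mem_filter.1 (Finset.mem_of_mem_erase hl)).2

theorem map_clusterProd_ne_zero (s : ClusterSeed ι) (S : Set ι)
    {B : Subring (RationalFunctions ι)} {F : Type*} [Field F] (χ : B →+* F)
    (hm : ∀ j, s.cluster j ∈ B) (h : ∀ j ∈ S, χ ⟨s.cluster j, hm j⟩ ≠ 0)
    (hB : s.clusterProd S ∈ B) : χ ⟨s.clusterProd S, hB⟩ ≠ 0 := by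
  classical
  have : (⟨s.clusterProd S, hB⟩ : B) = ∏ j with j ∈ S, ⟨s.cluster j, hm j⟩ :=
    Subtype.ext (by simp [clusterProd])
  rw [this, map_prod]
  exact Finset.prod_ne_zero_iff.2 fun j hj => h j (Finset.mem_filter.1 hj).2

variable [DecidableEq ι]

theorem MutationEquiv.cluster_mem_clusterAlgebra {s t : ClusterSeed ι} (h : MutationEquiv s t)
    (i : ι) : t.cluster i ∈ s.clusterAlgebra :=
  Subring.subset_closure (Or.inl ⟨t, h, i, rfl⟩)

theorem inv_mem_clusterAlgebra (s : ClusterSeed ι) {i : ι} (hi : i ∈ s.quiver.frozen) :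
    (s.cluster i)⁻¹ ∈ s.clusterAlgebra :=
  Subring.subset_closure (Or.inr ⟨i, hi, rfl⟩)

theorem MutationEquiv.clusterAlgebra_eq {s t : ClusterSeed ι}
    (hs : AlgebraicIndependent ℚ s.cluster) (h : MutationEquiv s t) :
    t.clusterAlgebra = s.clusterAlgebra := by
  have h1 : t.clusterVariables = s.clusterVariables := by
    ext f
    constructor
    · rintro ⟨u, hu, i, rfl⟩; exact ⟨u, h.trans hu, i, rfl⟩
    · rintro ⟨u, hu, i, rfl⟩; exact ⟨u, (h.symm hs).trans hu, i, rfl⟩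
  have h2 : t.frozenInverses = s.frozenInverses := by
    unfold frozenInverses
    rw [frozen_eq_of_mutationEquiv h]
    ext f
    constructor <;> rintro ⟨i, hi, rfl⟩ <;> refine ⟨i, hi, ?_⟩ <;>
      rw [h.cluster_eq_of_mem_frozen hi]
  rw [clusterAlgebra, clusterAlgebra, h1, h2]

/-- If freezing `S` leaves an isolated seed, then inverting the variables in `S` turns the cluster
algebra into the lower bound of this isolated seed. By the Laurent phenomenon the lower bound
contains all cluster variables. -/
theorem isLocalizationAt_lowerBound_freeze {s : ClusterSeed ι}
    (hs : AlgebraicIndependent ℚ s.cluster) {S : Set ι} (hq : (s.freeze S).quiver.IsIsolated) :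
    s.clusterAlgebra.IsLocalizationAt (s.freeze S).lowerBound (s.clusterProd S) := by
  have hmem : ∀ j, s.cluster j ∈ s.clusterAlgebra := fun j =>
    MutationEquiv.cluster_mem_clusterAlgebra Relation.ReflTransGen.refl j
  have hfrozen : ∀ j ∈ (s.freeze S).quiver.frozen, (s.cluster j)⁻¹ ∈ (s.freeze S).lowerBound := by
    intro j hj
    refine Subring.subset_closure ⟨j, trivial, Or.inr ?_⟩
    rw [numerator_of_mem _ hj, one_mul]
    rfl
  refine Subring.IsLocalizationAt.of_closure (clusterProd_mem s S fun j _ => hmem j)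
    (clusterProd_ne_zero hs S) ?_ (clusterProd_inv_mem s S fun j hj => hfrozen j (Or.inr hj)) ?_
  · refine Subring.closure_le.2 ?_
    rintro f (⟨u, hu, i, rfl⟩ | ⟨i, hi, rfl⟩)
    · refine mem_lowerBound_of_forall (s := s.freeze S) hs hq fun t ht => ?_
      obtain ⟨v, hv, rfl⟩ := ht.exists_of_freeze
      exact MutationEquiv.cluster_mem_laurentRing ((hv.symm hs).trans hu)
        (algebraicIndependent_of_mutationEquiv hs hv) i
    · exact hfrozen i (Or.inl hi)
  · rintro f ⟨i, -, rfl | rfl⟩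
    · exact ⟨0, by rw [pow_zero, mul_one]; exact hmem i⟩
    · by_cases hi : i ∈ (s.freeze S).quiver.frozen
      · rw [numerator_of_mem _ hi, one_mul]
        rcases hi with hi | hi
        · exact ⟨0, by rw [pow_zero, mul_one]; exact inv_mem_clusterAlgebra s hi⟩
        · exact ⟨1, by rw [pow_one]; exact inv_mul_clusterProd_mem hs hi fun j _ => hmem j⟩
      · refine ⟨0, ?_⟩
        rw [numerator_of_notMem _ hi, pow_zero, mul_one]
        have hi' : i ∉ s.quiver.frozen := fun h => hi (Or.inl h)
        have := (mutationEquiv_mutate s hi').cluster_mem_clusterAlgebra i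
        rwa [mutate_cluster_self] at this

/-- For an acyclic seed, freezing the variables that do not vanish at a given point of the spectrum
leaves an isolated seed. Otherwise there would be a mutable vertex `k` such that some variable with
an arrow to `k` vanishes, but no variable with an arrow from `k` does; this contradicts the exchange
relation at `k`. -/
theorem isIsolated_freeze_of_isAcyclic {s : ClusterSeed ι} (hs : AlgebraicIndependent ℚ s.cluster)
    (hac : s.quiver.IsAcyclic) {F : Type*} [Field F] (χ : s.clusterAlgebra →+* F)
    (hm : ∀ j, s.cluster j ∈ s.clusterAlgebra) :
    (s.freeze {j | χ ⟨s.cluster j, hm j⟩ ≠ 0}).quiver.IsIsolated := by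
  set Z : Set ι := {j | j ∉ s.quiver.frozen ∧ χ ⟨s.cluster j, hm j⟩ = 0} with hZ
  have hfrozen : ∀ j ∈ s.quiver.frozen, χ ⟨s.cluster j, hm j⟩ ≠ 0 := by
    intro j hj
    have hu : IsUnit (⟨s.cluster j, hm j⟩ : s.clusterAlgebra) :=
      IsUnit.of_mul_eq_one ⟨_, inv_mem_clusterAlgebra s hj⟩
        (Subtype.ext (mul_inv_cancel₀ (hs.ne_zero j)))
    exact (hu.map χ).ne_zero
  have key : ∀ a ∈ Z, ∀ b ∈ Z, ¬ 0 < s.quiver.arrows a b := by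
    intro a ha b hb hab
    let r : ι → ι → Prop := fun i j => Relation.TransGen s.quiver.MutableArrow j i
    have : IsTrans ι r := ⟨fun _ _ _ h1 h2 => h2.trans h1⟩
    have : Std.Irrefl r := ⟨hac⟩
    have hwf : WellFounded r := Finite.wellFounded_of_trans_of_irrefl r
    obtain ⟨k, ⟨hk, c, hc, hck⟩, hmin⟩ :=
      hwf.has_min {k | k ∈ Z ∧ ∃ c ∈ Z, 0 < s.quiver.arrows c k} ⟨b, hb, a, ha, hab⟩
    have hout : ∀ l ∈ Z, ¬ 0 < s.quiver.arrows k l := fun l hl hkl =>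
      hmin l ⟨hl, k, hk, hkl⟩ (Relation.TransGen.single ⟨hk.1, hl.1, hkl⟩)
    let X : ι → s.clusterAlgebra := fun l => ⟨s.cluster l, hm l⟩
    have hrel : (⟨(s.mutate k).cluster k, (mutationEquiv_mutate s hk.1).cluster_mem_clusterAlgebra k⟩ :
        s.clusterAlgebra) * X k = ∏ j, X j ^ (s.quiver.arrows k j).toNat +
          ∏ j, X j ^ (-s.quiver.arrows k j).toNat := by
      have h1 : (s.mutate k).cluster k * s.cluster k = s.exchange k := by
        rw [mutate_cluster_self, inv_mul_cancel_right₀ (hs.ne_zero k)]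
      exact Subtype.ext (h1.trans (by simp [exchange, X]))
    have hrel' := congrArg χ hrel
    have hXk : χ (X k) = 0 := hk.2
    have hin : ∏ j, χ (X j) ^ (-s.quiver.arrows k j).toNat = 0 := by
      refine Finset.prod_eq_zero (Finset.mem_univ c) ?_
      have hXc : χ (X c) = 0 := hc.2
      rw [hXc, zero_pow]
      have := s.quiver.skew k c
      omega
    simp only [map_mul, map_add, map_prod, map_pow, hXk, mul_zero, hin, add_zero] at hrel'
    refine Finset.prod_ne_zero_iff.2 (fun l _ => ?_) hrel'.symm
    by_cases hl : 0 < s.quiver.arrows k l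
    · refine pow_ne_zero _ fun h0 => hout l ⟨fun hlf => hfrozen l hlf h0, h0⟩ hl
    · rw [Int.toNat_of_nonpos (not_lt.1 hl), pow_zero]
      exact one_ne_zero
  have hZ' : ∀ i, i ∉ (s.freeze {j | χ ⟨s.cluster j, hm j⟩ ≠ 0}).quiver.frozen → i ∈ Z :=
    fun i hi => ⟨fun h => hi (Or.inl h), by
      by_contra h
      exact hi (Or.inr h)⟩
  intro i hi j hj
  have h1 := key i (hZ' i hi) j (hZ' j hj)
  have h2 := key j (hZ' j hj) i (hZ' i hi)
  have h3 := s.quiver.skew i j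
  change s.quiver.arrows i j = 0
  omega

theorem IsAcyclicLocalization.isLocalizationAt {s t : ClusterSeed ι} {S : Set ι}
    (hs : AlgebraicIndependent ℚ s.cluster) (h : IsAcyclicLocalization s t S) :
    s.clusterAlgebra.IsLocalizationAt (t.freeze S).clusterAlgebra (t.clusterProd S) := by
  have ht := algebraicIndependent_of_mutationEquiv hs h.mutationEquiv
  have hm := fun j => h.mutationEquiv.cluster_mem_clusterAlgebra j
  rw [h.eq_localization]
  refine Subring.IsLocalizationAt.of_closure (clusterProd_mem t S fun j _ => hm j)
    (clusterProd_ne_zero ht S) ?_ ?_ ?_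
  · exact fun f hf => Subring.subset_closure (Or.inl hf)
  · exact clusterProd_inv_mem t S fun j hj => Subring.subset_closure (Or.inr ⟨j, hj, rfl⟩)
  · rintro f (hf | ⟨j, hj, rfl⟩)
    · exact ⟨0, by simpa using hf⟩
    · exact ⟨1, by rw [pow_one]; exact inv_mul_clusterProd_mem ht hj fun j _ => hm j⟩

/-- Every point of the spectrum of a locally acyclic cluster algebra has a basic open neighbourhood
whose ring of functions is the lower bound of an isolated seed. -/
theorem IsLocallyAcyclic.exists_isLocalizationAt {s : ClusterSeed ι}
    (hs : AlgebraicIndependent ℚ s.cluster) (hloc : s.IsLocallyAcyclic)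
    (p : PrimeSpectrum s.clusterAlgebra) :
    ∃ (f : s.clusterAlgebra) (w : ClusterSeed ι), f ∉ p.asIdeal ∧
      AlgebraicIndependent ℚ w.cluster ∧ w.quiver.IsIsolated ∧
      s.clusterAlgebra.IsLocalizationAt w.lowerBound f := by
  obtain ⟨r, t, S, hloc, hcover⟩ := hloc
  obtain ⟨i, hi⟩ := Set.mem_iUnion.1 (hcover ▸ Set.mem_univ p)
  have hch := hloc i
  generalize t i = t at hi hch
  generalize S i = S at hi hch
  have ht := algebraicIndependent_of_mutationEquiv hs hch.mutationEquiv
  have hm := fun j => hch.mutationEquiv.cluster_mem_clusterAlgebra j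
  have hloc1 := hch.isLocalizationAt hs
  -- The point as a homomorphism to a field.
  let χ : s.clusterAlgebra →+* FractionRing (s.clusterAlgebra ⧸ p.asIdeal) :=
    (algebraMap _ _).comp (Ideal.Quotient.mk p.asIdeal)
  have hχ : ∀ a, χ a = 0 ↔ a ∈ p.asIdeal := by
    intro a
    rw [RingHom.comp_apply, FaithfulSMul.algebraMap_eq_zero_iff, Ideal.Quotient.eq_zero_iff_mem]
  have hχ1 : χ ⟨t.clusterProd S, hloc1.mem⟩ ≠ 0 :=
    map_clusterProd_ne_zero t S χ hm (fun j hj h0 => hi j hj ⟨_, (hχ _).1 h0, rfl⟩) _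
  obtain ⟨χ', hχ'⟩ := hloc1.exists_lift χ hχ1
  obtain ⟨t', ht', hac⟩ := hch.isAcyclic
  have hAlg : t'.clusterAlgebra = (t.freeze S).clusterAlgebra :=
    MutationEquiv.clusterAlgebra_eq (s := t.freeze S) ht ht'
  have hti : AlgebraicIndependent ℚ t'.cluster :=
    algebraicIndependent_of_mutationEquiv (s := t.freeze S) ht ht'
  have hmt' : ∀ j, t'.cluster j ∈ t'.clusterAlgebra := fun j =>
    MutationEquiv.cluster_mem_clusterAlgebra Relation.ReflTransGen.refl j
  -- The variables of `t'` are cluster variables of the whole cluster algebra, too.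
  have hm' : ∀ j, t'.cluster j ∈ s.clusterAlgebra := by
    obtain ⟨u, hu, rfl⟩ := ht'.exists_of_freeze
    exact fun j => MutationEquiv.cluster_mem_clusterAlgebra (hch.mutationEquiv.trans hu) j
  let χ'' : t'.clusterAlgebra →+* FractionRing (s.clusterAlgebra ⧸ p.asIdeal) :=
    χ'.comp (Subring.inclusion hAlg.le)
  set S' : Set ι := {j | χ'' ⟨t'.cluster j, hmt' j⟩ ≠ 0} with hS'
  have hiso : (t'.freeze S').quiver.IsIsolated := isIsolated_freeze_of_isAcyclic hti hac χ'' hmt'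
  have hloc2 := isLocalizationAt_lowerBound_freeze hti hiso
  rw [hAlg] at hloc2
  have hP' : t'.clusterProd S' ∈ s.clusterAlgebra := clusterProd_mem _ _ fun j _ => hm' j
  have hχ2 : χ ⟨t'.clusterProd S', hP'⟩ ≠ 0 := by
    refine map_clusterProd_ne_zero t' S' χ hm' (fun j hj => ?_) _
    rw [← hχ' _ (hm' j)]
    exact hj
  have hloc3 := hloc1.trans hloc2 hP'
  refine ⟨⟨_, hloc3.mem⟩, t'.freeze S', fun hp => ?_, hti, hiso, hloc3⟩
  have h0 := (hχ _).2 hp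
  have hmul : (⟨t.clusterProd S * t'.clusterProd S', hloc3.mem⟩ : s.clusterAlgebra) =
      ⟨_, hloc1.mem⟩ * ⟨_, hP'⟩ := rfl
  rw [hmul, map_mul] at h0
  exact (mul_ne_zero hχ1 hχ2) h0

end ClusterSeed

theorem theorem4p2 {ι : Type u} [Fintype ι] [DecidableEq ι] (s : ClusterSeed ι)
    (hs : AlgebraicIndependent ℚ s.cluster) (hloc : s.IsLocallyAcyclic) :
    Algebra.FiniteType ℤ s.clusterAlgebra ∧
      IsIntegrallyClosed s.clusterAlgebra ∧
      IsLocallyCompleteIntersectionRing s.clusterAlgebra := by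
  refine ⟨Algebra.FiniteType.of_forall_prime fun p => ?_,
    IsIntegrallyClosed.of_forall_prime fun p => ?_,
    IsLocallyCompleteIntersectionRing.of_forall_prime fun p => ?_⟩ <;>
    obtain ⟨f, w, hf, hw, hq, hL⟩ := ClusterSeed.IsLocallyAcyclic.exists_isLocalizationAt hs hloc p
  · exact ⟨f, _, hf, hL, exchangeRing.finiteType _ _ _⟩
  · exact ⟨f, _, hf, hL, ClusterSeed.isIntegrallyClosed_lowerBound hw hq⟩
  · exact ⟨f, _, hf, hL, ClusterSeed.isCompleteIntersectionRing_lowerBound hw hq⟩
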